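/- Let $d\ge 1$ be an integer and let $\mathbb R^d$ carry the norm $|x|=\sum_{i=1}^d|x_i|$. For probability measures $\mu,\nu$ on $\mathbb R^d$ with finite first moment, let $\mathcal W(\mu,\nu)=\inf_\pi\int|x-y|\,\pi(dx,dy)$, where $\pi$ ranges over the couplings of $\mu$ and $\nu$, and for vectors of $N\ge 1$ such measures put $\mathcal W^{\oplus}(\boldsymbol\mu,\boldsymbol\nu)=\sum_{k=1}^N\mathcal W(\mu_k,\nu_k)$. For every $\theta>1$ and every $d\ge 1$ there is a constant $C(\theta,d)>0$ such that the following holds. Let $N\ge 1$, and let $\boldsymbol\mu=(\mu_1,\dots,\mu_N)$ be probability measures on $\mathbb R^d$ that are the marginals of some martingale $(S_1,\dots,S_N)$ (a martingale in its own filtration), with $\int|x|^\theta\,\mu_N(dx)\le M<\infty$. On a probability space let, for each $k$, $X_{k,1},X_{k,2},\dots$ be independent random vectors with law $\mu_k$ (no condition is imposed on the joint law for different $k$), and let $\hat{\boldsymbol\mu}^n=(\hat\mu^n_1,\dots,\hat\mu^n_N)$ with $\hat\mu^n_k=\frac1n\sum_{i=1}^n\delta_{X_{k,i}}$. Then, for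 all $n\ge 1$, $\mathcal W^{\oplus}(\hat{\boldsymbol\mu}^n,\boldsymbol\mu)$ is a random variable with values in $[0,\infty]$ and $$\mathbb E\big[\mathcal W^{\oplus}(\hat{\boldsymbol\mu}^n,\boldsymbol\mu)\big]\le\chi(n):=N\,C(\theta,d)\,(1+M)\,r(n),$$ where $$r(n)=\begin{cases} n^{1/\theta-1} & \text{if } d=1,\ 1<\theta<2,\\ (1+\log n)\,n^{-1/2} & \text{if } d=1,\ \theta=2,\\ n^{-1/2} & \text{if } d=1,\ \theta>2,\\ n^{1/\theta-1} & \text{if } d=2,\ 1<\theta<2,\\ (1+(\log n)^2)\,n^{-1/2} & \text{if } d=2,\ \theta=2,\\ (1+\log n)\,n^{-1/2} & \text{if } d=2,\ \theta>2,\\ n^{1/\theta-1} & \text{if } d\ge 3,\ 1<\theta<d/(d-1),\\ (1+\log n)\,n^{-1/d} & \text{if } d\ge 3,\ \theta=d/(d-1),\\ n^{-1/d} & \text{if } d\ge 3,\ \theta>d/(d-1). \end{cases}$$ In consequence, $\mathbb P\big[\mathcal W^{\oplus}(\hat{\boldsymbol\mu}^n,\boldsymbol\mu)>\varepsilon\big]\le\chi(n)/\varepsilon$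 for every $\varepsilon>0$. -/

import Mathlib

open MeasureTheory ProbabilityTheory
open scoped ENNReal

/-- `ℝ^d` endowed with the `ℓ¹` norm `|x| = ∑ i, |x i|` (and its Borel sigma-field). -/
abbrev L1Space (d : ℕ) : Type := PiLp 1 (fun _ : Fin d => ℝ)

/-- The canonical filtration `F_k = σ(S_1, …, S_k)` on the path space `(ℝ^d)^N`, generated by the
coordinate process `S_k(x_1, …, x_N) = x_k`. -/
noncomputable def coordFiltration (d N : ℕ) :
    Filtration (Fin N) (inferInstance : MeasurableSpace (Fin N → L1Space d)) :=
  Filtration.natural (fun (k : Fin N) (x : Fin N → L1Space d) => x k)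
    (fun k => (measurable_pi_apply k).stronglyMeasurable)

/-- `P` is a martingale transport plan for the vector of marginals `μ`: a probability measure on
the path space with marginals `μ k` under which the coordinate process is a martingale. -/
structure IsMartingalePlan {d N : ℕ} (μ : Fin N → Measure (L1Space d))
    (P : Measure (Fin N → L1Space d)) : Prop where
  isProbabilityMeasure : IsProbabilityMeasure P
  marginal : ∀ k : Fin N, P.map (fun x => x k) = μ k
  martingale : Martingale (fun (k : Fin N) (x : Fin N → L1Space d) => x k) (coordFiltration d N) P

/-- The Wasserstein distance of order one for the `ℓ¹` norm: the infimum of the transport cost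
`E_π[|S_1 - S_2|]` over all couplings `π` of `μ` and `ν`. -/
noncomputable def wasserstein {d : ℕ} (μ ν : Measure (L1Space d)) : ℝ≥0∞ :=
  ⨅ (π : Measure (L1Space d × L1Space d)) (_ : π.map Prod.fst = μ) (_ : π.map Prod.snd = ν),
    ∫⁻ z, ENNReal.ofReal ‖z.1 - z.2‖ ∂π

/-- The product metric: the sum of the Wasserstein distances between the components. -/
noncomputable def wassersteinSum {d N : ℕ} (μ ν : Fin N → Measure (L1Space d)) : ℝ≥0∞ :=
  ∑ k, wasserstein (μ k) (ν k)

/-- The empirical measure `(1/n) ∑_{i < n} δ_{x i}` of the first `n` terms of a sequence. -/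
noncomputable def empirical {d : ℕ} (n : ℕ) (x : ℕ → L1Space d) : Measure (L1Space d) :=
  (n : ℝ≥0∞)⁻¹ • ∑ i ∈ Finset.range n, Measure.dirac (x i)

/-- The rate of convergence in dimension `d ≥ 1` under a finite moment of order `θ > 1`. -/
noncomputable def rate (θ : ℝ) (d n : ℕ) : ℝ :=
  if d = 1 then
    if θ < 2 then (n : ℝ) ^ (1 / θ - 1)
    else if θ = 2 then (1 + Real.log n) * (n : ℝ) ^ (-(1 / 2) : ℝ)
    else (n : ℝ) ^ (-(1 / 2) : ℝ)
  else if d = 2 then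
    if θ < 2 then (n : ℝ) ^ (1 / θ - 1)
    else if θ = 2 then (1 + Real.log n ^ 2) * (n : ℝ) ^ (-(1 / 2) : ℝ)
    else (1 + Real.log n) * (n : ℝ) ^ (-(1 / 2) : ℝ)
  else
    if θ < (d : ℝ) / ((d : ℝ) - 1) then (n : ℝ) ^ (1 / θ - 1)
    else if θ = (d : ℝ) / ((d : ℝ) - 1) then (1 + Real.log n) * (n : ℝ) ^ (-(1 / (d : ℝ)))
    else (n : ℝ) ^ (-(1 / (d : ℝ)))

/-- The bound `χ(n) = N C (1 + M) rate(n)`, where `C` is a constant and `M` bounds the moment. -/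
noncomputable def chi (C M θ : ℝ) (d N n : ℕ) : ℝ :=
  (N : ℝ) * (C * (1 + M)) * rate θ d n

/-! ### Elementary bounds for the transport distance -/

section Wasserstein

variable {d : ℕ}

/-! Expectation is additive, so the joint law of the samples for different `k` is irrelevant. The
martingale property enters only through conditional Jensen
(`IsMartingalePlan.lintegral_norm_rpow_le`): the `θ`-moment of every marginal is at most that of the
last one. What remains is a mean rate for one law with `θ`-moment at most `M`
(`exists_lintegral_wasserstein_empirical_le_rate`); the tail bound is then Markov's inequality.

For one law, split space into dyadic annuli of radius `2 ^ m` and each annulus into nested cubes of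
side `2 ^ m / 2 ^ l`. Transporting along this tree costs, per cell `A`, about `2 ^ (m - l)` times
the discrepancy of the two masses of `A` (`wasserstein_map_cells_le`). The mean discrepancy of an
empirical measure is at most `2 μ(A)` and at most `√(μ(A) / n)`. An annulus has mass `O((1 + M) 2 ^
(-θ m))` and contains `O(2 ^ (l d))` cubes, so Cauchy–Schwarz bounds the pair `(l, m)` by a multiple
of `scaleTerm`. Stopping the tree at level `L` leaves an error of order `2 ^ (-L)`.

The cases of `rate` come from summing `scaleTerm`, a minimum of two exponentials in `l` and `m`. For
heavy tails the sum over `m` is dominated by the crossing of the two branches, which gives `n ^ (1 /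
θ - 1)`. Otherwise the sum over `l` comes first and produces `n ^ (-e)` with `e = 1 / max d 2`. A
logarithm appears whenever a branch is constant: in `l` if `d = 2`, in `m` if `θ (1 - e) = 1`. -/

lemma wasserstein_le_lintegral {μ ν : Measure (L1Space d)} {π : Measure (L1Space d × L1Space d)}
    (h₁ : π.map Prod.fst = μ) (h₂ : π.map Prod.snd = ν) :
    wasserstein μ ν ≤ ∫⁻ z, ENNReal.ofReal ‖z.1 - z.2‖ ∂π :=
  iInf_le_of_le π (iInf_le_of_le h₁ (iInf_le_of_le h₂ le_rfl))

lemma wasserstein_map_map_le {α : Type*} [MeasurableSpace α] (ρ : Measure α) {f g : α → L1Space d}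
    (hf : Measurable f) (hg : Measurable g) :
    wasserstein (ρ.map f) (ρ.map g) ≤ ∫⁻ x, ENNReal.ofReal ‖f x - g x‖ ∂ρ := by
  have hfg : Measurable fun x => (f x, g x) := hf.prodMk hg
  refine (wasserstein_le_lintegral (π := ρ.map fun x => (f x, g x)) ?_ ?_).trans ?_
  · rw [Measure.map_map measurable_fst hfg]; rfl
  · rw [Measure.map_map measurable_snd hfg]; rfl
  · rw [lintegral_map (by fun_prop) hfg]

/-- Shared mass need not move: it is coupled to itself along the diagonal. -/
lemma wasserstein_add_right_le (μ ν γ : Measure (L1Space d)) :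
    wasserstein (μ + γ) (ν + γ) ≤ wasserstein μ ν := by
  refine le_iInf fun π => le_iInf fun h₁ => le_iInf fun h₂ => ?_
  have hd : Measurable fun x : L1Space d => (x, x) := measurable_id.prodMk measurable_id
  refine (wasserstein_le_lintegral (π := π + γ.map fun x => (x, x)) ?_ ?_).trans ?_
  · rw [Measure.map_add _ _ measurable_fst, h₁, Measure.map_map measurable_fst hd]
    exact congrArg (μ + ·) Measure.map_id
  · rw [Measure.map_add _ _ measurable_snd, h₂, Measure.map_map measurable_snd hd]
    exact congrArg (ν + ·) Measure.map_id
  · rw [lintegral_add_measure, lintegral_map (by fun_prop) hd]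
    simp

lemma exists_kernel_of_coupling {μ ν : Measure (L1Space d)} [IsFiniteMeasure μ]
    {π : Measure (L1Space d × L1Space d)} (h₁ : π.map Prod.fst = μ) (h₂ : π.map Prod.snd = ν) :
    ∃ κ : Kernel (L1Space d) (L1Space d), IsMarkovKernel κ ∧ π = μ ⊗ₘ κ ∧ ν = κ ∘ₘ μ := by
  have : IsFiniteMeasure π := by
    refine ⟨?_⟩
    have := measure_lt_top μ Set.univ
    rwa [← h₁, Measure.map_apply measurable_fst MeasurableSet.univ] at this
  refine ⟨π.condKernel, inferInstance, ?_, ?_⟩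
  · rw [← h₁]; exact (π.disintegrate π.condKernel).symm
  · rw [← h₂, ← Measure.snd_compProd, ← h₁]
    exact congrArg Measure.snd (π.disintegrate π.condKernel).symm

/-- Gluing: disintegrate both couplings into kernels `κ` and `η`, and couple `μ` with `ρ` through
the composition `η ∘ₖ κ`, which forgets the middle point. Finiteness of `μ` and `ν` is what
disintegration requires. -/
lemma wasserstein_triangle (μ ν ρ : Measure (L1Space d)) [IsFiniteMeasure μ] [IsFiniteMeasure ν] :
    wasserstein μ ρ ≤ wasserstein μ ν + wasserstein ν ρ := by
  conv_rhs => unfold wasserstein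
  simp only [ENNReal.iInf_add, ENNReal.add_iInf]
  refine le_iInf fun π' => le_iInf fun h₁' => le_iInf fun h₂' => le_iInf fun π => le_iInf fun h₁ =>
    le_iInf fun h₂ => ?_
  obtain ⟨κ, _, rfl, hν⟩ := exists_kernel_of_coupling h₁ h₂
  obtain ⟨η, _, rfl, hρ⟩ := exists_kernel_of_coupling h₁' h₂'
  have hc : Measurable fun z : L1Space d × L1Space d => ENNReal.ofReal ‖z.1 - z.2‖ := by fun_prop
  refine (wasserstein_le_lintegral (π := μ ⊗ₘ (η ∘ₖ κ)) ?_ ?_).trans ?_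
  · exact Measure.fst_compProd _ _
  · rw [hρ, hν, Measure.comp_assoc, ← Measure.snd_compProd]; rfl
  rw [Measure.lintegral_compProd hc, Measure.lintegral_compProd hc, Measure.lintegral_compProd hc]
  have hm : Measurable fun y => ∫⁻ z, ENNReal.ofReal ‖y - z‖ ∂(η y) :=
    Measurable.lintegral_kernel_prod_right' hc
  have hm' : Measurable fun y => ∫⁻ z, ENNReal.ofReal ‖y - z‖ ∂(κ y) :=
    Measurable.lintegral_kernel_prod_right' hc
  rw [hν, Measure.lintegral_bind κ.aemeasurable hm.aemeasurable, ← lintegral_add_left hm']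
  refine lintegral_mono fun x => ?_
  rw [Kernel.lintegral_comp _ _ _ (by fun_prop), ← lintegral_add_left (by fun_prop)]
  refine lintegral_mono fun y => ?_
  calc ∫⁻ z, ENNReal.ofReal ‖x - z‖ ∂(η y)
      ≤ ∫⁻ z, (ENNReal.ofReal ‖x - y‖ + ENNReal.ofReal ‖y - z‖) ∂(η y) := by
        refine lintegral_mono fun z => ?_
        rw [← ENNReal.ofReal_add (norm_nonneg _) (norm_nonneg _)]
        exact ENNReal.ofReal_le_ofReal (norm_sub_le_norm_sub_add_norm_sub _ _ _)
    _ = _ := by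
        rw [lintegral_add_left measurable_const]; simp

end Wasserstein

/-! ### Transport along a tree of nested partitions -/

section TreeBound

lemma ENNReal.sub_eq_sub_of_add_eq_add {x y a b : ℝ≥0∞} (hy : y ≠ ∞) (hb : b ≠ ∞)
    (h : x + b = y + a) : x - y = a - b := by
  have h₁ : x - y = (x + b) - (y + b) := by
    rw [ENNReal.add_sub_add_eq_sub_right hb]
  rw [h₁, h, ENNReal.add_sub_add_eq_sub_left hy]

variable {d : ℕ} {ι : Type*}

/-- The discrete measure with mass `a i` at the point `c i`. -/
noncomputable def weightedDirac (c : ι → L1Space d) (a : ι → ℝ≥0∞) : Measure (L1Space d) :=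
  Measure.sum fun i => a i • Measure.dirac (c i)

lemma weightedDirac_add (c : ι → L1Space d) (a b : ι → ℝ≥0∞) :
    weightedDirac c (a + b) = weightedDirac c a + weightedDirac c b := by
  simp [weightedDirac, Measure.sum_add_sum, add_smul]

lemma lintegral_weightedDirac (c : ι → L1Space d) (a : ι → ℝ≥0∞) {f : L1Space d → ℝ≥0∞}
    (hf : Measurable f) : ∫⁻ x, f x ∂(weightedDirac c a) = ∑' i, a i * f (c i) := by
  simp [weightedDirac, lintegral_sum_measure, lintegral_smul_measure, lintegral_dirac' _ hf]

variable [Countable ι] [MeasurableSpace ι] [MeasurableSingletonClass ι]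

lemma map_comp_eq_weightedDirac {q : L1Space d → ι} (hq : Measurable q) (c : ι → L1Space d)
    (α : Measure (L1Space d)) :
    α.map (fun x => c (q x)) = weightedDirac c fun i => α (q ⁻¹' {i}) := by
  have hc : Measurable c := measurable_of_countable c
  have : α.map (fun x => c (q x)) = (α.map q).map c := (Measure.map_map hc hq).symm
  rw [this, weightedDirac]
  conv_lhs => rw [← Measure.sum_smul_dirac (α.map q)]
  rw [Measure.map_sum hc.aemeasurable]
  congr 1
  ext1 i
  rw [Measure.map_smul, Measure.map_dirac' hc, Measure.map_apply hq (measurableSet_singleton i)]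

/-- Transport cost between two discretized measures along a nested sequence of countable
partitions: the excess mass of each cell travels to the representative of the parent cell. -/
theorem wasserstein_map_cells_le (q : ℕ → L1Space d → ι) (c : ℕ → ι → L1Space d)
    (hq : ∀ k, Measurable (q k)) (hqc : ∀ m k, m ≤ k → ∀ x, q m (c k (q k x)) = q m x)
    (h0 : ∀ x y, c 0 (q 0 x) = c 0 (q 0 y)) (r : ℕ → ι → ℝ≥0∞)
    (hr : ∀ k x, ENNReal.ofReal ‖c (k + 1) (q (k + 1) x) - c k (q k x)‖ ≤ r k (q (k + 1) x))
    (k : ℕ) (α β : Measure (L1Space d)) [IsFiniteMeasure α] [IsFiniteMeasure β]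
    (hαβ : α Set.univ = β Set.univ) :
    wasserstein (α.map fun x => c k (q k x)) (β.map fun x => c k (q k x)) ≤
      ∑ j ∈ Finset.range k, ∑' i, r j i * ((α (q (j + 1) ⁻¹' {i}) - β (q (j + 1) ⁻¹' {i})) +
        (β (q (j + 1) ⁻¹' {i}) - α (q (j + 1) ⁻¹' {i}))) := by
  have hT : ∀ k, Measurable fun x => c k (q k x) := fun k =>
    (measurable_of_countable (c k)).comp (hq k)
  induction k generalizing α β with
  | zero =>
    have : α.map (fun x => c 0 (q 0 x)) = β.map fun x => c 0 (q 0 x) := by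
      have hc : (fun x => c 0 (q 0 x)) = fun _ => c 0 (q 0 0) := funext fun x => h0 x 0
      rw [hc, Measure.map_const, Measure.map_const, hαβ]
    rw [this]
    refine (wasserstein_map_map_le β (hT 0) (hT 0)).trans ?_
    simp
  | succ k ih =>
    set a : ι → ℝ≥0∞ := fun i => α (q (k + 1) ⁻¹' {i}) with ha
    set b : ι → ℝ≥0∞ := fun i => β (q (k + 1) ⁻¹' {i}) with hb
    set D := weightedDirac (c (k + 1)) with hD
    have hα : α.map (fun x => c (k + 1) (q (k + 1) x)) = D a :=
      map_comp_eq_weightedDirac (hq _) _ α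
    have hβ : β.map (fun x => c (k + 1) (q (k + 1) x)) = D b :=
      map_comp_eq_weightedDirac (hq _) _ β
    -- Truncated subtraction splits each measure into its excess over the other and the common part
    -- `a ⊓ b`. Only the excesses will move.
    have ha' : D a = D (a - b) + D (a ⊓ b) := by
      rw [hD, ← weightedDirac_add]; congr 1; ext i; exact tsub_add_min.symm
    have hb' : D b = D (b - a) + D (a ⊓ b) := by
      rw [hD, ← weightedDirac_add, inf_comm]; congr 1; ext i; exact tsub_add_min.symm
    have hex : D (a - b) + D b = D (b - a) + D a := by
      rw [hD, ← weightedDirac_add, ← weightedDirac_add]; congr 1; ext i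
      simp [tsub_add_eq_max, max_comm]
    have hfa : IsFiniteMeasure (D a) := hα ▸ inferInstance
    have hfb : IsFiniteMeasure (D b) := hβ ▸ inferInstance
    have hfa' : IsFiniteMeasure (D (a - b)) := by
      refine isFiniteMeasure_of_le (D a) ?_
      rw [ha']; exact Measure.le_add_right le_rfl
    have hfb' : IsFiniteMeasure (D (b - a)) := by
      refine isFiniteMeasure_of_le (D b) ?_
      rw [hb']; exact Measure.le_add_right le_rfl
    have hval : ∀ B, MeasurableSet B → D (a - b) B + D b B = D (b - a) B + D a B := fun B _ => by
      simpa using congrArg (fun m : Measure _ => m B) hex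
    have huniv : D (a - b) Set.univ = D (b - a) Set.univ := by
      have h := hval _ MeasurableSet.univ
      rw [← hα, ← hβ, Measure.map_apply (hT _) MeasurableSet.univ,
        Measure.map_apply (hT _) MeasurableSet.univ, Set.preimage_univ, hαβ] at h
      exact (ENNReal.add_left_inj (measure_ne_top β _)).1 h
    have hcell : ∀ m, m ≤ k + 1 → ∀ i, D a (q m ⁻¹' {i}) = α (q m ⁻¹' {i}) ∧
        D b (q m ⁻¹' {i}) = β (q m ⁻¹' {i}) := fun m hm i => by
      have hms := hq m (measurableSet_singleton i)
      have : (fun x => c (k + 1) (q (k + 1) x)) ⁻¹' (q m ⁻¹' {i}) = q m ⁻¹' {i} := by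
        ext x; simp [hqc m (k + 1) hm x]
      rw [← hα, ← hβ, Measure.map_apply (hT _) hms, Measure.map_apply (hT _) hms, this]
      exact ⟨rfl, rfl⟩
    -- Cancelling the common part does not change signed differences, so the excesses have the same
    -- discrepancies on coarser cells as `α` and `β`. Hence the induction hypothesis for the
    -- excesses returns the sums wanted for `α` and `β`.
    have hdiff : ∀ m, m ≤ k + 1 → ∀ i,
        D (a - b) (q m ⁻¹' {i}) - D (b - a) (q m ⁻¹' {i}) =
          α (q m ⁻¹' {i}) - β (q m ⁻¹' {i}) ∧
        D (b - a) (q m ⁻¹' {i}) - D (a - b) (q m ⁻¹' {i}) =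
          β (q m ⁻¹' {i}) - α (q m ⁻¹' {i}) := fun m hm i => by
      have h := hval _ (hq m (measurableSet_singleton i))
      rw [(hcell m hm i).1, (hcell m hm i).2] at h
      exact ⟨ENNReal.sub_eq_sub_of_add_eq_add (measure_ne_top _ _) (measure_ne_top _ _) h,
        ENNReal.sub_eq_sub_of_add_eq_add (measure_ne_top _ _) (measure_ne_top _ _) h.symm⟩
    -- A label of an empty cell has an arbitrary representative, about which `hr` says nothing;
    -- hence the requirement that `w` vanish there.
    have hcost : ∀ w : ι → ℝ≥0∞, (∀ i, i ∉ Set.range (q (k + 1)) → w i = 0) →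
        ∫⁻ x, ENNReal.ofReal ‖x - c k (q k x)‖ ∂(D w) ≤ ∑' i, r k i * w i := fun w hw => by
      have hm : Measurable fun x => c k (q k x) := hT k
      rw [hD, lintegral_weightedDirac _ _ (by fun_prop)]
      refine ENNReal.tsum_le_tsum fun i => ?_
      rw [mul_comm]
      by_cases hi : i ∈ Set.range (q (k + 1))
      · obtain ⟨x, rfl⟩ := hi
        gcongr
        rw [hqc k (k + 1) (Nat.le_succ k) x]
        exact hr k x
      · simp [hw i hi]
    have hnull : ∀ i, i ∉ Set.range (q (k + 1)) → q (k + 1) ⁻¹' {i} = ∅ := fun i hi => by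
      ext x; simpa using fun h => hi ⟨x, h⟩
    have h₁ : wasserstein (D (a - b)) ((D (a - b)).map fun x => c k (q k x)) ≤
        ∑' i, r k i * (a i - b i) := by
      have := wasserstein_map_map_le (D (a - b)) measurable_id (hT k)
      rw [Measure.map_id] at this
      refine this.trans (hcost _ fun i hi => ?_)
      simp [ha, hnull i hi]
    have h₂ : wasserstein ((D (b - a)).map fun x => c k (q k x)) (D (b - a)) ≤
        ∑' i, r k i * (b i - a i) := by
      have := wasserstein_map_map_le (D (b - a)) (hT k) measurable_id
      rw [Measure.map_id] at this
      refine this.trans (le_trans (le_of_eq ?_) (hcost _ fun i hi => ?_))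
      · exact lintegral_congr fun x => by rw [id, norm_sub_rev]
      · simp [hb, hnull i hi]
    rw [hα, hβ, ha', hb', Finset.sum_range_succ]
    refine (wasserstein_add_right_le _ _ _).trans ?_
    refine (wasserstein_triangle _ ((D (a - b)).map fun x => c k (q k x)) _).trans ?_
    refine (add_le_add h₁ ((wasserstein_triangle _ ((D (b - a)).map fun x => c k (q k x)) _).trans
      (add_le_add (ih _ _ huniv) h₂))).trans (le_of_eq ?_)
    rw [add_left_comm, ← ENNReal.tsum_add]
    congr 1
    · refine Finset.sum_congr rfl fun j hj => tsum_congr fun i => ?_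
      have hj' : j + 1 ≤ k + 1 := by have := Finset.mem_range.1 hj; omega
      rw [(hdiff _ hj' i).1, (hdiff _ hj' i).2]
    · exact tsum_congr fun i => (mul_add _ _ _).symm

end TreeBound

/-! ### Empirical measures: measurability and fluctuations of cell masses -/

section Empirical

variable {d : ℕ}

/-- As images of one law on the indices, two empirical measures are coupled index by index. -/
lemma empirical_eq_map (n : ℕ) (x : ℕ → L1Space d) :
    empirical n x =
      ((n : ℝ≥0∞)⁻¹ • ∑ i ∈ Finset.range n, Measure.dirac i : Measure ℕ).map x := by
  have hx : Measurable x := measurable_of_countable x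
  rw [Measure.map_smul, empirical, ← Measure.mapₗ_apply_of_measurable hx, map_sum]
  simp [Measure.mapₗ_apply_of_measurable hx, Measure.map_dirac' hx]

lemma empirical_apply (n : ℕ) (x : ℕ → L1Space d) {A : Set (L1Space d)} (hA : MeasurableSet A) :
    empirical n x A = (n : ℝ≥0∞)⁻¹ * ∑ i ∈ Finset.range n, A.indicator 1 (x i) := by
  simp [empirical, Measure.smul_apply, Measure.finsetSum_apply, Measure.dirac_apply' _ hA]

lemma isProbabilityMeasure_empirical {n : ℕ} (hn : 1 ≤ n) (x : ℕ → L1Space d) :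
    IsProbabilityMeasure (empirical n x) := by
  refine ⟨?_⟩
  rw [empirical_apply n x MeasurableSet.univ]
  simp only [Set.indicator_univ, Pi.one_apply, Finset.sum_const, Finset.card_range, nsmul_eq_mul,
    mul_one]
  exact ENNReal.inv_mul_cancel (by simp; omega) (by simp)

lemma wasserstein_empirical_empirical_le (n : ℕ) (x y : ℕ → L1Space d) :
    wasserstein (empirical n x) (empirical n y) ≤
      (n : ℝ≥0∞)⁻¹ * ∑ i ∈ Finset.range n, ENNReal.ofReal ‖x i - y i‖ := by
  rw [empirical_eq_map, empirical_eq_map]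
  refine (wasserstein_map_map_le _ (measurable_of_countable x) (measurable_of_countable y)).trans ?_
  rw [lintegral_smul_measure, lintegral_finsetSum_measure]
  simp

/-- By the triangle inequality, moving the sample points a little raises the distance by at most
their mean displacement. This one-sided statement needs no finiteness of the distance and suffices
for measurability. -/
lemma upperSemicontinuous_wasserstein_empirical {n : ℕ} (hn : 1 ≤ n) (μ : Measure (L1Space d)) :
    UpperSemicontinuous fun x : ℕ → L1Space d => wasserstein (empirical n x) μ := by
  intro x b hb
  have hcont : Continuous fun y : ℕ → L1Space d =>
      (n : ℝ≥0∞)⁻¹ * ∑ i ∈ Finset.range n, ENNReal.ofReal ‖y i - x i‖ := by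
    refine ENNReal.continuous_const_mul (by simp; omega) |>.comp ?_
    refine continuous_finsetSum _ fun i _ => ENNReal.continuous_ofReal.comp ?_
    fun_prop
  have hlim := (hcont.tendsto x).add_const (wasserstein (empirical n x) μ)
  simp only [sub_self, norm_zero, ENNReal.ofReal_zero, Finset.sum_const_zero, mul_zero,
    zero_add] at hlim
  filter_upwards [hlim.eventually_lt_const hb] with y hy
  have := isProbabilityMeasure_empirical hn x
  have := isProbabilityMeasure_empirical hn y
  exact ((wasserstein_triangle _ (empirical n x) _).trans
    (add_le_add_left (wasserstein_empirical_empirical_le n y x) _)).trans_lt hy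

lemma measurable_wasserstein_empirical {Ω : Type*} [MeasurableSpace Ω] {X : ℕ → Ω → L1Space d}
    (hX : ∀ i, Measurable (X i)) {n : ℕ} (hn : 1 ≤ n) (μ : Measure (L1Space d)) :
    Measurable fun ω => wasserstein (empirical n fun i => X i ω) μ :=
  (upperSemicontinuous_wasserstein_empirical hn μ).measurable.comp (measurable_pi_lambda _ hX)

lemma lintegral_enorm_sub_integral_le {Ω : Type*} [MeasurableSpace Ω] {P : Measure Ω}
    [IsProbabilityMeasure P] {Y : Ω → ℝ} (hY : MemLp Y 2 P) :
    ∫⁻ ω, ‖Y ω - P[Y]‖ₑ ∂P ≤ ENNReal.ofReal (Real.sqrt (Var[Y; P])) := by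
  rw [Real.sqrt_eq_rpow, ← ENNReal.ofReal_rpow_of_nonneg (variance_nonneg _ _) (by norm_num),
    ofReal_variance hY, evariance]
  have hm : AEStronglyMeasurable (fun ω => Y ω - P[Y]) P := hY.1.sub aestronglyMeasurable_const
  have := eLpNorm_le_eLpNorm_of_exponent_le (p := 1) (q := 2) (by norm_num) hm
  rw [eLpNorm_one_eq_lintegral_enorm, eLpNorm_eq_lintegral_rpow_enorm_toReal (by norm_num)
    (by norm_num)] at this
  simpa using this

variable {Ω : Type*} [MeasurableSpace Ω] {P : Measure Ω} {μ : Measure (L1Space d)}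
  {X : ℕ → Ω → L1Space d}

lemma lintegral_lintegral_empirical (hX : ∀ i, Measurable (X i)) (hμ : ∀ i, P.map (X i) = μ)
    {n : ℕ} (hn : 1 ≤ n) {f : L1Space d → ℝ≥0∞} (hf : Measurable f) :
    ∫⁻ ω, ∫⁻ x, f x ∂(empirical n fun i => X i ω) ∂P = ∫⁻ x, f x ∂μ := by
  have h : ∀ x : ℕ → L1Space d, ∫⁻ y, f y ∂(empirical n x) =
      (n : ℝ≥0∞)⁻¹ * ∑ i ∈ Finset.range n, f (x i) := fun x => by
    simp [empirical, lintegral_smul_measure, lintegral_finsetSum_measure, lintegral_dirac' _ hf]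
  simp_rw [h]
  have hm : ∀ i, Measurable fun ω => f (X i ω) := fun i => hf.comp (hX i)
  rw [lintegral_const_mul _ (Finset.measurable_fun_sum _ fun i _ => hm i),
    lintegral_finsetSum _ fun i _ => hm i]
  have hi : ∀ i, ∫⁻ ω, f (X i ω) ∂P = ∫⁻ x, f x ∂μ := fun i => by
    rw [← hμ i, lintegral_map hf (hX i)]
  simp_rw [hi]
  rw [Finset.sum_const, Finset.card_range, nsmul_eq_mul, ← mul_assoc,
    ENNReal.inv_mul_cancel (by simp; omega) (by simp), one_mul]

lemma lintegral_empirical_apply (hX : ∀ i, Measurable (X i)) (hμ : ∀ i, P.map (X i) = μ)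
    {n : ℕ} (hn : 1 ≤ n) {A : Set (L1Space d)} (hA : MeasurableSet A) :
    ∫⁻ ω, empirical n (fun i => X i ω) A ∂P = μ A := by
  simpa [lintegral_indicator_one hA] using
    lintegral_lintegral_empirical hX hμ hn (measurable_one.indicator hA)

lemma measurable_empirical_apply (hX : ∀ i, Measurable (X i)) (n : ℕ)
    {A : Set (L1Space d)} (hA : MeasurableSet A) :
    Measurable fun ω => empirical n (fun i => X i ω) A := by
  simp_rw [empirical_apply _ _ hA]
  exact (Finset.measurable_fun_sum _ fun i _ =>
    (measurable_one.indicator hA).comp (hX i)).const_mul _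

/-- The empirical mass has mean `μ A`. This crude bound is the better one for cells too light to be
well sampled. -/
lemma lintegral_empirical_deviation_le_two_mul [IsProbabilityMeasure P] (hX : ∀ i, Measurable (X i))
    (hμ : ∀ i, P.map (X i) = μ) {n : ℕ} (hn : 1 ≤ n) {A : Set (L1Space d)}
    (hA : MeasurableSet A) :
    ∫⁻ ω, ((empirical n (fun i => X i ω) A - μ A) + (μ A - empirical n (fun i => X i ω) A)) ∂P ≤
      2 * μ A := by
  calc _ ≤ ∫⁻ ω, (empirical n (fun i => X i ω) A + μ A) ∂P :=
        lintegral_mono fun ω => add_le_add tsub_le_self tsub_le_self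
    _ = _ := by
        rw [lintegral_add_left (measurable_empirical_apply hX n hA),
          lintegral_empirical_apply hX hμ hn hA]
        simp [two_mul]

/-- One of the two truncated differences vanishes; their sum is the form in which absolute
deviations appear in the tree bound. -/
lemma ENNReal.sub_add_sub_eq_enorm {a b : ℝ≥0∞} (ha : a ≠ ∞) (hb : b ≠ ∞) :
    (a - b) + (b - a) = ‖a.toReal - b.toReal‖ₑ := by
  rcases le_total a b with h | h
  · rw [tsub_eq_zero_of_le h, zero_add, ← ofReal_norm, Real.norm_eq_abs, abs_sub_comm,
      abs_of_nonneg (sub_nonneg.2 (ENNReal.toReal_mono hb h)), ← ENNReal.toReal_sub_of_le h hb,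
      ENNReal.ofReal_toReal (by finiteness)]
  · rw [tsub_eq_zero_of_le h, add_zero, ← ofReal_norm, Real.norm_eq_abs,
      abs_of_nonneg (sub_nonneg.2 (ENNReal.toReal_mono ha h)), ← ENNReal.toReal_sub_of_le h ha,
      ENNReal.ofReal_toReal (by finiteness)]

/-- The empirical mass averages `n` independent indicators of variance at most `μ A`, so its
variance is at most `μ A / n`; the mean deviation is at most the standard deviation. -/
lemma lintegral_empirical_deviation_le_sqrt [IsProbabilityMeasure P] (hX : ∀ i, Measurable (X i))
    (hind : iIndepFun X P) (hμ : ∀ i, P.map (X i) = μ) {n : ℕ} (hn : 1 ≤ n)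
    {A : Set (L1Space d)} (hA : MeasurableSet A) :
    ∫⁻ ω, ((empirical n (fun i => X i ω) A - μ A) + (μ A - empirical n (fun i => X i ω) A)) ∂P ≤
      ENNReal.ofReal (Real.sqrt (μ.real A / n)) := by
  have hn0 : (n : ℝ) ≠ 0 := by positivity
  have hprob : IsProbabilityMeasure μ := by
    rw [← hμ 0]; exact Measure.isProbabilityMeasure_map (hX 0).aemeasurable
  set g : L1Space d → ℝ := A.indicator 1 with hg
  have hgm : Measurable g := measurable_one.indicator hA
  set Z : ℕ → Ω → ℝ := fun i => g ∘ X i with hZ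
  have hZm : ∀ i, Measurable (Z i) := fun i => hgm.comp (hX i)
  have hgb : ∀ x, ‖g x‖ ≤ 1 := fun x => by
    by_cases hx : x ∈ A <;> simp [hg, hx]
  have hZL : ∀ i, MemLp (Z i) 2 P := fun i =>
    MemLp.of_bound (hZm i).aestronglyMeasurable 1 (ae_of_all _ fun ω => hgb _)
  have hZint : ∀ i, ∫ ω, Z i ω ∂P = μ.real A := fun i => by
    have := integral_map (hX i).aemeasurable (μ := P) (f := g) hgm.aestronglyMeasurable
    rw [hμ i, hg, integral_indicator_one hA] at this
    exact this.symm
  have hZvar : ∀ i, Var[Z i; P] ≤ μ.real A := fun i => by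
    refine (variance_le_expectation_sq (hZm i).aestronglyMeasurable).trans (le_of_eq ?_)
    rw [← hZint i]
    refine integral_congr_ae (ae_of_all _ fun ω => ?_)
    by_cases hx : X i ω ∈ A <;> simp [hZ, hg, hx]
  set S : Ω → ℝ := ∑ i ∈ Finset.range n, Z i with hS
  have hSL : MemLp S 2 P := memLp_finsetSum' _ fun i _ => hZL i
  have hSvar : Var[S; P] ≤ n * μ.real A := by
    rw [hS, IndepFun.variance_sum (fun i _ => hZL i)
      (fun i _ j _ hij => (hind.indepFun hij).comp hgm hgm)]
    refine (Finset.sum_le_sum fun i _ => hZvar i).trans (le_of_eq ?_)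
    simp
  have hSint : ∫ ω, S ω ∂P = n * μ.real A := by
    simp only [hS, Finset.sum_apply]
    rw [integral_finsetSum _ fun i _ => (hZL i).integrable (by norm_num)]
    simp [hZint]
  set Y : Ω → ℝ := fun ω => (n : ℝ)⁻¹ * S ω with hY
  have hYL : MemLp Y 2 P := hSL.const_mul _
  have hYint : ∫ ω, Y ω ∂P = μ.real A := by
    simp only [hY]
    rw [integral_const_mul, hSint]; field_simp
  have hYvar : Var[Y; P] ≤ μ.real A / n := by
    rw [hY, variance_const_mul]
    calc (n : ℝ)⁻¹ ^ 2 * Var[S; P] ≤ (n : ℝ)⁻¹ ^ 2 * (n * μ.real A) := by gcongr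
      _ = _ := by field_simp
  have hYeq : ∀ ω, (empirical n (fun i => X i ω) A).toReal = Y ω := fun ω => by
    rw [empirical_apply _ _ hA, ENNReal.toReal_mul, ENNReal.toReal_inv, ENNReal.toReal_natCast,
      ENNReal.toReal_sum]
    · simp only [hY, hS, Finset.sum_apply]
      congr 1
      refine Finset.sum_congr rfl fun i _ => ?_
      by_cases hx : X i ω ∈ A <;> simp [hZ, hg, hx]
    · intro i _
      by_cases hx : X i ω ∈ A <;> simp [hx]
  calc _ = ∫⁻ ω, ‖Y ω - P[Y]‖ₑ ∂P := by
        refine lintegral_congr fun ω => ?_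
        have := isProbabilityMeasure_empirical hn fun i => X i ω
        rw [ENNReal.sub_add_sub_eq_enorm (measure_ne_top _ _) (measure_ne_top _ _), hYeq, hYint]
        rfl
    _ ≤ ENNReal.ofReal (Real.sqrt (Var[Y; P])) := lintegral_enorm_sub_integral_le hYL
    _ ≤ _ := ENNReal.ofReal_le_ofReal (Real.sqrt_le_sqrt hYvar)

end Empirical

/-! ### Moments of the marginals of a martingale -/

lemma IsMartingalePlan.lintegral_norm_rpow_le {d N : ℕ} {μ : Fin N → Measure (L1Space d)}
    {P : Measure (Fin N → L1Space d)} (hP : IsMartingalePlan μ P) {θ M : ℝ} (hθ : 1 ≤ θ)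
    {k l : Fin N} (hkl : k ≤ l) (hint : Integrable (fun x => ‖x‖ ^ θ) (μ l))
    (hM : ∫ x, ‖x‖ ^ θ ∂(μ l) ≤ M) :
    ∫⁻ x, ENNReal.ofReal (‖x‖ ^ θ) ∂(μ k) ≤ ENNReal.ofReal M := by
  have := hP.isProbabilityMeasure
  have hpow : Measurable fun x : L1Space d => ‖x‖ ^ θ := by fun_prop
  rw [← hP.marginal l] at hint hM
  have hl : Measurable fun x : Fin N → L1Space d => x l := measurable_pi_apply l
  have hk : Measurable fun x : Fin N → L1Space d => x k := measurable_pi_apply k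
  rw [integrable_map_measure hpow.aestronglyMeasurable hl.aemeasurable] at hint
  rw [integral_map hl.aemeasurable hpow.aestronglyMeasurable] at hM
  rw [← hP.marginal k, lintegral_map (by fun_prop) hk]
  have hm := hP.martingale.condExp_ae_eq hkl
  -- Conditional Jensen for the convex function `‖·‖ ^ θ`, as `x k` is the conditional expectation
  -- of `x l`.
  have hle : (fun x : Fin N → L1Space d => ‖x k‖ ^ θ) ≤ᵐ[P]
      P[fun x => ‖x l‖ ^ θ | coordFiltration d N k] := by
    filter_upwards [hm, Integrable.norm_condExp_rpow_le (m := coordFiltration d N k) hθ hint]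
      with x hx hx'
    rwa [hx] at hx'
  calc ∫⁻ x, ENNReal.ofReal (‖x k‖ ^ θ) ∂P
      ≤ ∫⁻ x, ENNReal.ofReal ((P[fun x => ‖x l‖ ^ θ | coordFiltration d N k]) x) ∂P :=
        lintegral_mono_ae (hle.mono fun x hx => ENNReal.ofReal_le_ofReal hx)
    _ = ENNReal.ofReal (∫ x, (P[fun x => ‖x l‖ ^ θ | coordFiltration d N k]) x ∂P) := by
        rw [ofReal_integral_eq_lintegral_ofReal integrable_condExp
          (hle.mono fun x hx => (Real.rpow_nonneg (norm_nonneg _) _).trans hx)]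
    _ ≤ ENNReal.ofReal M := by
        rw [integral_condExp ((coordFiltration d N).le k)]
        exact ENNReal.ofReal_le_ofReal hM

/-! ### Dyadic annuli and cubes -/

section DyadicCells

variable {d : ℕ}

/-- The index `n` of the dyadic annulus `2 ^ (n - 1) < ‖x‖ ≤ 2 ^ n` (`‖x‖ ≤ 1` if `n = 0`). -/
noncomputable def annulus (x : L1Space d) : ℕ := Nat.clog 2 ⌈‖x‖⌉₊

lemma norm_le_two_pow_annulus (x : L1Space d) : ‖x‖ ≤ 2 ^ annulus x := by
  have h := Nat.le_pow_clog (b := 2) (by norm_num) ⌈‖x‖⌉₊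
  exact (Nat.le_ceil _).trans (by exact_mod_cast h)

lemma two_pow_annulus_le (x : L1Space d) : (2 : ℝ) ^ annulus x ≤ max 1 (2 * ‖x‖) := by
  rcases Nat.eq_zero_or_pos (annulus x) with h | h
  · simp [h]
  · refine le_max_of_le_right ?_
    have h₁ : 2 ^ (annulus x - 1) < ⌈‖x‖⌉₊ := Nat.pow_pred_clog_lt_self (by norm_num) <| by
      by_contra! hle
      exact h.ne' (Nat.clog_of_right_le_one hle 2)
    have h₂ := (Nat.lt_ceil.1 h₁).le
    obtain ⟨m, hm⟩ : ∃ m, annulus x = m + 1 := ⟨annulus x - 1, by omega⟩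
    rw [hm, Nat.add_sub_cancel] at h₂
    push_cast at h₂
    rw [hm, pow_succ]
    linarith

lemma measurable_annulus : Measurable (annulus : L1Space d → ℕ) :=
  (measurable_of_countable (Nat.clog 2)).comp (Nat.measurable_ceil.comp measurable_norm)

/-- The label of the dyadic cell containing a point: at level `0` the whole space, at level `l + 1`
the trace on an annulus of radius `2 ^ n` of a cube of side `2 ^ n / 2 ^ l`. -/
noncomputable def dyadicCell : ℕ → L1Space d → ℕ × (Fin d → ℤ)
  | 0, _ => (0, 0)
  | l + 1, x => (annulus x, fun i => ⌊x i * 2 ^ l / 2 ^ annulus x⌋)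

/-- A representative point of each dyadic cell. -/
noncomputable def dyadicRep : ℕ → ℕ × (Fin d → ℤ) → L1Space d
  | 0, _ => 0
  | l + 1, i => Function.invFun (dyadicCell (l + 1)) i

lemma measurable_dyadicCell (l : ℕ) :
    Measurable (dyadicCell l : L1Space d → ℕ × (Fin d → ℤ)) := by
  cases l with
  | zero => exact measurable_const
  | succ l =>
    refine measurable_annulus.prodMk (measurable_pi_lambda _ fun i => Int.measurable_floor.comp ?_)
    have h : Measurable fun x : L1Space d => (2 : ℝ) ^ annulus x :=
      (measurable_of_countable fun n : ℕ => (2 : ℝ) ^ n).comp measurable_annulus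
    have h' : Measurable fun x : L1Space d => x i := by fun_prop
    exact (h'.mul_const _).div h

/-- The cells are nested because `⌊z * 2 ^ e⌋` determines `⌊z⌋`: the integer `⌊z⌋ * 2 ^ e` lies
below `⌊z * 2 ^ e⌋`. By symmetry one inequality between the coarse floors is enough. -/
lemma dyadicCell_eq_of_le {m l : ℕ} (hml : m ≤ l) {x y : L1Space d}
    (h : dyadicCell l x = dyadicCell l y) : dyadicCell m x = dyadicCell m y := by
  have key : ∀ x y : L1Space d, ∀ m l, m ≤ l → dyadicCell (l + 1) x = dyadicCell (l + 1) y →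
      ∀ i, ⌊x i * 2 ^ m / 2 ^ annulus x⌋ ≤ ⌊y i * 2 ^ m / 2 ^ annulus y⌋ := by
    intro x y m l hml h i
    obtain ⟨h₁, h₂⟩ := Prod.ext_iff.1 h
    have h₃ : ⌊x i * 2 ^ l / 2 ^ annulus x⌋ = ⌊y i * 2 ^ l / 2 ^ annulus y⌋ := congrFun h₂ i
    obtain ⟨e, rfl⟩ := Nat.exists_eq_add_of_le hml
    have hz : ∀ w : L1Space d, w i * 2 ^ (m + e) / 2 ^ annulus w =
        w i * 2 ^ m / 2 ^ annulus w * 2 ^ e := fun w => by rw [pow_add]; ring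
    rw [hz, hz] at h₃
    set z := ⌊x i * 2 ^ m / 2 ^ annulus x⌋ with hzdef
    have h₄ : (z : ℝ) * 2 ^ e ≤ x i * 2 ^ m / 2 ^ annulus x * 2 ^ e := by
      gcongr; exact Int.floor_le _
    have h₅ : z * 2 ^ e ≤ ⌊y i * 2 ^ m / 2 ^ annulus y * 2 ^ e⌋ := by
      rw [← h₃]; exact Int.le_floor.2 (by push_cast; exact h₄)
    have h₆ := Int.le_floor.1 h₅
    push_cast at h₆
    exact Int.le_floor.2 (le_of_mul_le_mul_right h₆ (by positivity))
  cases m with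
  | zero => rfl
  | succ m =>
    obtain ⟨l, rfl⟩ : ∃ k, l = k + 1 := ⟨l - 1, by omega⟩
    exact Prod.ext (Prod.ext_iff.1 h).1 (funext fun i =>
      le_antisymm (key x y m l (by omega) h i) (key y x m l (by omega) h.symm i))

lemma dyadicCell_dyadicRep {m l : ℕ} (hml : m ≤ l) (x : L1Space d) :
    dyadicCell m (dyadicRep l (dyadicCell l x)) = dyadicCell m x := by
  cases l with
  | zero => obtain rfl : m = 0 := by omega
            rfl
  | succ l => exact dyadicCell_eq_of_le hml (Function.invFun_eq ⟨x, rfl⟩)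

lemma norm_sub_le_of_dyadicCell_eq {l : ℕ} {x y : L1Space d}
    (h : dyadicCell (l + 1) x = dyadicCell (l + 1) y) :
    ‖x - y‖ ≤ d * 2 ^ annulus x / 2 ^ l := by
  obtain ⟨h₁, h₂⟩ := Prod.ext_iff.1 h
  have h₁' : annulus x = annulus y := h₁
  have hi : ∀ i, ‖x i - y i‖ ≤ 2 ^ annulus x / 2 ^ l := fun i => by
    have h₃ : ⌊x i * 2 ^ l / 2 ^ annulus x⌋ = ⌊y i * 2 ^ l / 2 ^ annulus y⌋ := congrFun h₂ i
    rw [← h₁'] at h₃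
    have h₄ := Int.abs_sub_lt_one_of_floor_eq_floor h₃
    rw [← sub_div, ← sub_mul, abs_div, abs_mul, abs_of_pos (by positivity : (0 : ℝ) < 2 ^ l),
      abs_of_pos (by positivity : (0 : ℝ) < 2 ^ annulus x), div_lt_one (by positivity)] at h₄
    rw [Real.norm_eq_abs, le_div_iff₀ (by positivity)]
    exact h₄.le
  rw [PiLp.norm_eq_of_nat 1 (by simp)]
  simp only [pow_one, Nat.cast_one, div_one, Real.rpow_one, PiLp.sub_apply]
  refine (Finset.sum_le_sum fun i _ => hi i).trans (le_of_eq ?_)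
  simp; ring

/-- Both representatives lie in one cell of level `l`, whose cube has side `2 * 2 ^ annulus x / 2 ^
l`; this is the factor `2`. For `l = 0` the parent is the origin and the radius of the annulus is
the bound. -/
lemma norm_dyadicRep_sub_le (hd : 1 ≤ d) (l : ℕ) (x : L1Space d) :
    ‖dyadicRep (l + 1) (dyadicCell (l + 1) x) - dyadicRep l (dyadicCell l x)‖ ≤
      2 * d * 2 ^ annulus x / 2 ^ l := by
  have hd' : (1 : ℝ) ≤ d := by exact_mod_cast hd
  have hy := dyadicCell_dyadicRep (le_refl (l + 1)) x
  have hyann : annulus (dyadicRep (l + 1) (dyadicCell (l + 1) x)) = annulus x :=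
    (Prod.ext_iff.1 hy).1
  cases l with
  | zero =>
    have h := norm_le_two_pow_annulus (dyadicRep (0 + 1) (dyadicCell (0 + 1) x))
    rw [hyann] at h
    simp only [dyadicRep, sub_zero, pow_zero, div_one] at h ⊢
    refine h.trans ?_
    have : (0 : ℝ) < 2 ^ annulus x := by positivity
    nlinarith
  | succ l =>
    have h₁ := dyadicCell_dyadicRep (Nat.le_succ (l + 1)) x
    have h₂ := dyadicCell_dyadicRep (le_refl (l + 1)) x
    have h := norm_sub_le_of_dyadicCell_eq (h₁.trans h₂.symm)
    rw [hyann] at h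
    refine h.trans (le_of_eq ?_)
    rw [pow_succ]; field_simp

lemma norm_sub_dyadicRep_le (l : ℕ) (x : L1Space d) :
    ‖x - dyadicRep (l + 1) (dyadicCell (l + 1) x)‖ ≤ d / 2 ^ l * (1 + 2 * ‖x‖) := by
  have h := norm_sub_le_of_dyadicCell_eq (dyadicCell_dyadicRep (le_refl (l + 1)) x).symm
  have h' : (2 : ℝ) ^ annulus x ≤ 1 + 2 * ‖x‖ := (two_pow_annulus_le x).trans <|
    max_le (by linarith [norm_nonneg x]) (by linarith)
  calc _ ≤ d / 2 ^ l * (2 : ℝ) ^ annulus x := h.trans (le_of_eq (by ring))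
    _ ≤ _ := by gcongr

/-- The labels of the cubes of level `l + 1` that meet the ball of their annulus. -/
noncomputable def dyadicLabels (d l : ℕ) : Finset (Fin d → ℤ) :=
  Fintype.piFinset fun _ => Finset.Icc (-2 ^ l) (2 ^ l)

/-- A coordinate may equal the outer radius, so the label `2 ^ l` occurs and the interval of labels
is closed at both ends. -/
lemma dyadicCell_mem_dyadicLabels (l : ℕ) (x : L1Space d) :
    (dyadicCell (l + 1) x).2 ∈ dyadicLabels d l := by
  refine Fintype.mem_piFinset.2 fun i => ?_
  have hx : |x i| ≤ 2 ^ annulus x := (PiLp.norm_apply_le x i).trans (norm_le_two_pow_annulus x)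
  obtain ⟨h₁, h₂⟩ := abs_le.1 hx
  have hpos : (0 : ℝ) < 2 ^ annulus x := by positivity
  have hl : (0 : ℝ) < 2 ^ l := by positivity
  refine Finset.mem_Icc.2 ⟨Int.le_floor.2 ?_, ?_⟩
  · push_cast
    rw [le_div_iff₀ hpos]; nlinarith
  · have h : (⌊x i * 2 ^ l / 2 ^ annulus x⌋ : ℝ) ≤ 2 ^ l :=
      (Int.floor_le _).trans (by rw [div_le_iff₀ hpos]; nlinarith)
    exact_mod_cast h

lemma card_dyadicLabels_le (d l : ℕ) : ((dyadicLabels d l).card : ℝ) ≤ 4 ^ d * 2 ^ (l * d) := by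
  have h : (dyadicLabels d l).card = (2 * 2 ^ l + 1) ^ d := by
    have : ((2 : ℤ) ^ l + 1 + 2 ^ l).toNat = 2 * 2 ^ l + 1 := by
      have : (2 : ℤ) ^ l + 1 + 2 ^ l = ((2 * 2 ^ l + 1 : ℕ) : ℤ) := by push_cast; ring
      rw [this, Int.toNat_natCast]
    simp [dyadicLabels, Fintype.card_piFinset, this]
  rw [h, pow_mul, ← mul_pow]
  push_cast
  have : (1 : ℝ) ≤ 2 ^ l := one_le_pow₀ (by norm_num)
  gcongr
  linarith

end DyadicCells

/-! ### Multiscale bound for the mean distance -/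

section ExpectedDistance

variable {d : ℕ} {Ω : Type*} [MeasurableSpace Ω] {P : Measure Ω} [IsProbabilityMeasure P]
  {μ : Measure (L1Space d)} {X : ℕ → Ω → L1Space d}

/-- Both bounds on a cell are summed over the cubes of one annulus. The masses add up to at most
that of the annulus; for the square roots, Cauchy–Schwarz brings in the number of cubes. -/
lemma tsum_lintegral_empirical_deviation_le (hX : ∀ i, Measurable (X i))
    (hind : iIndepFun X P) (hμ : ∀ i, P.map (X i) = μ) {n : ℕ} (hn : 1 ≤ n) (l m : ℕ) :
    ∑' v, ∫⁻ ω, ((empirical n (fun i => X i ω) (dyadicCell (l + 1) ⁻¹' {(m, v)}) -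
        μ (dyadicCell (l + 1) ⁻¹' {(m, v)})) + (μ (dyadicCell (l + 1) ⁻¹' {(m, v)}) -
        empirical n (fun i => X i ω) (dyadicCell (l + 1) ⁻¹' {(m, v)}))) ∂P ≤
      ENNReal.ofReal (min (2 * μ.real (annulus ⁻¹' {m}))
        (Real.sqrt (4 ^ d * 2 ^ (l * d) * μ.real (annulus ⁻¹' {m}) / n))) := by
  have hprob : IsProbabilityMeasure μ := by
    rw [← hμ 0]; exact Measure.isProbabilityMeasure_map (hX 0).aemeasurable
  set A : (Fin d → ℤ) → Set (L1Space d) := fun v => dyadicCell (l + 1) ⁻¹' {(m, v)} with hA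
  have hAm : ∀ v, MeasurableSet (A v) := fun v =>
    measurable_dyadicCell (l + 1) (measurableSet_singleton _)
  have hsum : ∑ v ∈ dyadicLabels d l, μ.real (A v) ≤ μ.real (annulus ⁻¹' {m}) := by
    rw [← measureReal_biUnion_finset _ fun v _ => hAm v]
    · refine measureReal_mono (Set.iUnion₂_subset fun v _ x hx => ?_)
      exact (Prod.ext_iff.1 (show dyadicCell (l + 1) x = (m, v) from hx)).1
    · intro v _ w _ hvw
      refine Set.disjoint_left.2 fun x hx hx' => hvw ?_
      exact (Prod.ext_iff.1 ((show dyadicCell (l + 1) x = (m, v) from hx).symm.trans hx')).2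
  rw [tsum_eq_sum (s := dyadicLabels d l)]
  · rw [ENNReal.ofReal_min]
    refine le_min ?_ ?_
    · refine (Finset.sum_le_sum fun v _ =>
        lintegral_empirical_deviation_le_two_mul hX hμ hn (hAm v)).trans ?_
      have h : ∀ v, 2 * μ (A v) = ENNReal.ofReal (2 * μ.real (A v)) := fun v => by
        rw [ENNReal.ofReal_mul (by norm_num), ofReal_measureReal]; simp
      simp_rw [h]
      rw [← ENNReal.ofReal_sum_of_nonneg fun v _ => by positivity, ← Finset.mul_sum]
      exact ENNReal.ofReal_le_ofReal (by gcongr)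
    · refine (Finset.sum_le_sum fun v _ =>
        lintegral_empirical_deviation_le_sqrt hX hind hμ hn (hAm v)).trans ?_
      rw [← ENNReal.ofReal_sum_of_nonneg fun v _ => Real.sqrt_nonneg _]
      refine ENNReal.ofReal_le_ofReal ?_
      have hcs := Real.sum_sqrt_mul_sqrt_le (dyadicLabels d l) (f := fun _ => 1)
        (g := fun v => μ.real (A v) / n) (fun _ => zero_le_one) (fun v => by positivity)
      simp only [Real.sqrt_one, one_mul] at hcs
      refine hcs.trans ?_
      rw [← Real.sqrt_mul (by positivity), ← Finset.sum_div, Finset.sum_const, nsmul_eq_mul,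
        mul_one, mul_div_assoc]
      have := card_dyadicLabels_le d l
      gcongr
  · intro v hv
    have : A v = ∅ := by
      ext x
      refine ⟨fun hx => hv ?_, fun hx => hx.elim⟩
      have := dyadicCell_mem_dyadicLabels l x
      rwa [show dyadicCell (l + 1) x = (m, v) from hx] at this
    simp [hA] at this
    simp [this]

/-- Multiscale bound for the expected Wasserstein distance between a law and the empirical measure
of a sample of size `n`. -/
theorem lintegral_wasserstein_empirical_le (hd : 1 ≤ d) (hX : ∀ i, Measurable (X i))
    (hind : iIndepFun X P) (hμ : ∀ i, P.map (X i) = μ) {n : ℕ} (hn : 1 ≤ n) (L : ℕ) :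
    ∫⁻ ω, wasserstein (empirical n fun i => X i ω) μ ∂P ≤
      (∑ l ∈ Finset.range (L + 1), ∑' m : ℕ, ENNReal.ofReal (2 * d * 2 ^ m / 2 ^ l *
        min (2 * μ.real (annulus ⁻¹' {m}))
          (Real.sqrt (4 ^ d * 2 ^ (l * d) * μ.real (annulus ⁻¹' {m}) / n)))) +
      2 * ∫⁻ x, ENNReal.ofReal (d / 2 ^ L * (1 + 2 * ‖x‖)) ∂μ := by
  have hprob : IsProbabilityMeasure μ := by
    rw [← hμ 0]; exact Measure.isProbabilityMeasure_map (hX 0).aemeasurable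
  set T : L1Space d → L1Space d := fun x => dyadicRep (L + 1) (dyadicCell (L + 1) x) with hTdef
  have hT : Measurable T :=
    (measurable_of_countable (dyadicRep (L + 1))).comp (measurable_dyadicCell (L + 1))
  set rem : L1Space d → ℝ≥0∞ := fun x => ENNReal.ofReal (d / 2 ^ L * (1 + 2 * ‖x‖)) with hrem
  have hremm : Measurable rem := by fun_prop
  set r : ℕ → ℕ × (Fin d → ℤ) → ℝ≥0∞ := fun l i => ENNReal.ofReal (2 * d * 2 ^ i.1 / 2 ^ l)
    with hr
  set D : Ω → ℕ → ℕ × (Fin d → ℤ) → ℝ≥0∞ := fun ω l i =>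
    (empirical n (fun i => X i ω) (dyadicCell (l + 1) ⁻¹' {i}) - μ (dyadicCell (l + 1) ⁻¹' {i})) +
      (μ (dyadicCell (l + 1) ⁻¹' {i}) - empirical n (fun i => X i ω) (dyadicCell (l + 1) ⁻¹' {i}))
    with hD
  have hDm : ∀ l i, Measurable fun ω => D ω l i := fun l i => by
    have h := measurable_empirical_apply hX n
      (measurable_dyadicCell (l + 1) (measurableSet_singleton i))
    exact (h.sub measurable_const).add (measurable_const.sub h)
  have hproj : ∀ (ν : Measure (L1Space d)), wasserstein ν (ν.map T) ≤ ∫⁻ x, rem x ∂ν ∧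
      wasserstein (ν.map T) ν ≤ ∫⁻ x, rem x ∂ν := fun ν => by
    have h₁ := wasserstein_map_map_le ν measurable_id hT
    have h₂ := wasserstein_map_map_le ν hT measurable_id
    rw [Measure.map_id] at h₁ h₂
    refine ⟨h₁.trans (lintegral_mono fun x => ENNReal.ofReal_le_ofReal ?_),
      h₂.trans (lintegral_mono fun x => ENNReal.ofReal_le_ofReal ?_)⟩
    · exact norm_sub_dyadicRep_le L x
    · rw [norm_sub_rev]; exact norm_sub_dyadicRep_le L x
  -- Three legs: discretize the empirical measure by `T`, cross the tree to the discretized `μ`,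
  -- then undo the discretization. The outer legs have the same mean cost, whence the factor `2` in
  -- the bound.
  have hpath : ∀ ω, wasserstein (empirical n fun i => X i ω) μ ≤
      (∫⁻ x, rem x ∂(empirical n fun i => X i ω)) +
        ((∑ l ∈ Finset.range (L + 1), ∑' i, r l i * D ω l i) + ∫⁻ x, rem x ∂μ) := fun ω => by
    have := isProbabilityMeasure_empirical hn fun i => X i ω
    refine (wasserstein_triangle _ ((empirical n fun i => X i ω).map T) _).trans
      (add_le_add (hproj _).1 ?_)
    refine (wasserstein_triangle _ (μ.map T) _).trans (add_le_add ?_ (hproj _).2)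
    refine wasserstein_map_cells_le dyadicCell dyadicRep measurable_dyadicCell
      (fun m k hmk x => dyadicCell_dyadicRep hmk x) (fun _ _ => rfl) r (fun k x => ?_) (L + 1) _ _
      (by simp)
    exact ENNReal.ofReal_le_ofReal (norm_dyadicRep_sub_le hd k x)
  have hmain : ∫⁻ ω, ∑ l ∈ Finset.range (L + 1), ∑' i, r l i * D ω l i ∂P ≤
      ∑ l ∈ Finset.range (L + 1), ∑' m : ℕ, ENNReal.ofReal (2 * d * 2 ^ m / 2 ^ l *
        min (2 * μ.real (annulus ⁻¹' {m}))
          (Real.sqrt (4 ^ d * 2 ^ (l * d) * μ.real (annulus ⁻¹' {m}) / n))) := by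
    rw [lintegral_finsetSum _ fun l _ => Measurable.tsum fun i =>
      (hDm l i).const_mul _]
    refine Finset.sum_le_sum fun l _ => ?_
    rw [lintegral_tsum fun i => ((hDm l i).const_mul _).aemeasurable, ENNReal.tsum_prod']
    refine ENNReal.tsum_le_tsum fun m => ?_
    simp_rw [lintegral_const_mul _ (hDm l _)]
    simp only [hr]
    rw [ENNReal.tsum_mul_left, ENNReal.ofReal_mul (by positivity)]
    gcongr
    exact tsum_lintegral_empirical_deviation_le hX hind hμ hn l m
  have hDsum : Measurable fun ω => ∑ l ∈ Finset.range (L + 1), ∑' i, r l i * D ω l i :=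
    Finset.measurable_fun_sum _ fun l _ => Measurable.tsum fun i =>
      (hDm l i).const_mul _
  refine (lintegral_mono hpath).trans ?_
  rw [lintegral_add_right _ (hDsum.add_const _), lintegral_add_left hDsum,
    lintegral_lintegral_empirical hX hμ hn hremm, lintegral_const, measure_univ, mul_one]
  refine (add_le_add le_rfl (add_le_add hmain le_rfl)).trans (le_of_eq ?_)
  rw [two_mul (lintegral μ rem), add_left_comm]

end ExpectedDistance

/-! ### Sums of minima of exponentials -/

section DyadicSums

/-- Uniform bound for the geometric sums `∑ l < K, 2 ^ (v - c l)`. -/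
lemma sum_two_rpow_sub_le {c : ℝ} (hc : 0 < c) (v : ℝ) (K : ℕ) :
    ∑ l ∈ Finset.range K, (2 : ℝ) ^ (v - c * l) ≤ (1 - (2 : ℝ) ^ (-c))⁻¹ * 2 ^ v := by
  have hρ : (2 : ℝ) ^ (-c) < 1 := Real.rpow_lt_one_of_one_lt_of_neg (by norm_num) (by linarith)
  have hρ0 : (0 : ℝ) ≤ 2 ^ (-c) := by positivity
  have h : ∀ l : ℕ, (2 : ℝ) ^ (v - c * l) = 2 ^ v * ((2 : ℝ) ^ (-c)) ^ l := fun l => by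
    rw [← Real.rpow_natCast, ← Real.rpow_mul (by norm_num), ← Real.rpow_add (by norm_num)]
    congr 1; ring
  simp_rw [h]
  rw [← Finset.mul_sum, mul_comm]
  gcongr
  rw [← tsum_geometric_of_lt_one hρ0 hρ]
  exact (summable_geometric_of_lt_one hρ0 hρ).sum_le_tsum _ fun i _ => by positivity

lemma inv_one_sub_two_rpow_neg_pos {c : ℝ} (hc : 0 < c) : 0 < (1 - (2 : ℝ) ^ (-c))⁻¹ := by
  have hρ : (2 : ℝ) ^ (-c) < 1 := Real.rpow_lt_one_of_one_lt_of_neg (by norm_num) (by linarith)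
  exact inv_pos.2 (by linarith)

/-- Splitting a sum at `k`, with geometric decay after `k`. -/
lemma sum_le_sum_range_add_of_decay {f : ℕ → ℝ} {c v : ℝ} (hc : 0 < c) (k K : ℕ)
    (hf0 : ∀ l, 0 ≤ f l) (hf : ∀ l, k ≤ l → f l ≤ 2 ^ (v - c * (l - k))) :
    ∑ l ∈ Finset.range K, f l ≤
      ∑ l ∈ Finset.range k, f l + (1 - (2 : ℝ) ^ (-c))⁻¹ * 2 ^ v := by
  calc ∑ l ∈ Finset.range K, f l ≤ ∑ l ∈ Finset.range (k + K), f l :=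
        Finset.sum_le_sum_of_subset_of_nonneg (Finset.range_mono (by omega)) fun l _ _ => hf0 l
    _ = ∑ l ∈ Finset.range k, f l + ∑ l ∈ Finset.range K, f (k + l) := Finset.sum_range_add _ _ _
    _ ≤ _ := by
        refine add_le_add le_rfl (le_trans ?_ (sum_two_rpow_sub_le hc v K))
        refine Finset.sum_le_sum fun l _ => (hf (k + l) (by omega)).trans (le_of_eq ?_)
        push_cast; congr 1; ring

/-- The sum of minima of a decreasing and an increasing geometric sequence is of the order of their
common value. -/
lemma exists_sum_min_two_rpow_le {a b : ℝ} (ha : 0 < a) (hb : 0 < b) :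
    ∃ C : ℝ, 0 < C ∧ ∀ (α β : ℝ) (K : ℕ),
      ∑ l ∈ Finset.range K, min ((2 : ℝ) ^ (α - a * l)) (2 ^ (β + b * l)) ≤
        C * 2 ^ ((b * α + a * β) / (a + b)) := by
  refine ⟨(1 - (2 : ℝ) ^ (-b))⁻¹ + (1 - (2 : ℝ) ^ (-a))⁻¹,
    add_pos (inv_one_sub_two_rpow_neg_pos hb) (inv_one_sub_two_rpow_neg_pos ha),
    fun α β K => ?_⟩
  -- The two exponents agree at the real point `l = s`, with common value `v`.
  set v := (b * α + a * β) / (a + b) with hv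
  set s := (α - β) / (a + b) with hs
  have hab : a + b ≠ 0 := by positivity
  have hα : α = v + a * s := by rw [hv, hs]; field_simp; ring
  have hβ : β = v - b * s := by rw [hv, hs]; field_simp; ring
  set k := ⌈s⌉₊ with hk
  have hdecay : ∀ l : ℕ, k ≤ l →
      min ((2 : ℝ) ^ (α - a * l)) (2 ^ (β + b * l)) ≤ 2 ^ (v - a * (l - k)) := fun l _ => by
    refine (min_le_left _ _).trans (Real.rpow_le_rpow_of_exponent_le (by norm_num) ?_)
    have : s ≤ k := Nat.le_ceil s
    rw [hα]; nlinarith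
  refine (sum_le_sum_range_add_of_decay ha k K (fun l => by positivity) hdecay).trans ?_
  rw [add_mul]
  refine add_le_add ?_ le_rfl
  -- Below the crossing, summation runs downwards from `k - 1 < s`, so the increasing branch decays
  -- geometrically.
  rw [← Finset.sum_range_reflect]
  refine le_trans (Finset.sum_le_sum fun l hl => ?_) (sum_two_rpow_sub_le hb v k)
  refine (min_le_right _ _).trans (Real.rpow_le_rpow_of_exponent_le (by norm_num) ?_)
  have hl' : l + 1 ≤ k := Finset.mem_range.1 hl
  have hsk : (k : ℝ) < s + 1 := Nat.ceil_lt_add_one <| by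
    by_contra! h
    have : k = 0 := Nat.ceil_eq_zero.2 h.le
    omega
  have hcast : ((k - 1 - l : ℕ) : ℝ) = k - 1 - l := by
    rw [Nat.sub_sub, Nat.cast_sub (by omega)]; push_cast; ring
  rw [hcast, hβ]
  nlinarith

/-- The contribution of the cells of level `l` in the annulus `m` to the expected distance, in
dimension `δ` and for `2 ^ ν` samples. -/
noncomputable def scaleTerm (θ δ ν : ℝ) (l m : ℕ) : ℝ :=
  min ((2 : ℝ) ^ ((1 - θ) * m - l)) (2 ^ ((1 - θ / 2) * m + (δ / 2 - 1) * l - ν / 2))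

lemma scaleTerm_nonneg (θ δ ν : ℝ) (l m : ℕ) : 0 ≤ scaleTerm θ δ ν l m := by
  unfold scaleTerm; positivity

/-- As `θ < 2`, for fixed `l` one branch decreases in `m` and the other increases. Their crossing
value is `2 ^ ((1 / θ - 1) * ν - (1 - (θ - 1) * δ / θ) * l)`, and `hδ` makes it summable in `l`. -/
lemma exists_sum_scaleTerm_le_of_heavy_tail {θ δ : ℝ} (h1 : 1 < θ) (h2 : θ < 2)
    (hδ : (θ - 1) * δ < θ) :
    ∃ C : ℝ, 0 < C ∧ ∀ (ν : ℝ) (L K : ℕ),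
      ∑ l ∈ Finset.range L, ∑ m ∈ Finset.range K, scaleTerm θ δ ν l m ≤
        C * 2 ^ ((1 / θ - 1) * ν) := by
  obtain ⟨C, hC, h⟩ := exists_sum_min_two_rpow_le (a := θ - 1) (b := 1 - θ / 2) (by linarith)
    (by linarith)
  have hθ : 0 < θ := by linarith
  have hc : 0 < 1 - (θ - 1) * δ / θ := by rw [sub_pos, div_lt_one hθ]; exact hδ
  refine ⟨C * (1 - (2 : ℝ) ^ (-(1 - (θ - 1) * δ / θ)))⁻¹,
    mul_pos hC (inv_one_sub_two_rpow_neg_pos hc), fun ν L K => ?_⟩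
  rw [mul_assoc]
  refine le_trans ?_ (mul_le_mul_of_nonneg_left (sum_two_rpow_sub_le hc _ L) hC.le)
  rw [Finset.mul_sum]
  refine Finset.sum_le_sum fun l _ => ?_
  refine le_trans (le_of_eq (Finset.sum_congr rfl fun m _ => ?_))
    ((h (-l) ((δ / 2 - 1) * l - ν / 2) K).trans (le_of_eq ?_))
  · unfold scaleTerm; congr 2 <;> ring
  · have h' : θ - 1 + (1 - θ / 2) = θ / 2 := by ring
    rw [h']; congr 2; field_simp; ring

/-- The sum over annuli left after summing over levels, with `e = 1 / max d 2`. Here the second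
branch alone decays in `m`. -/
lemma exists_sum_min_le_of_supercritical {θ e : ℝ} (h : 1 < θ * (1 - e)) :
    ∃ C : ℝ, 0 < C ∧ ∀ (ν : ℝ) (K : ℕ),
      ∑ m ∈ Finset.range K,
        min ((2 : ℝ) ^ ((1 - θ) * m)) (2 ^ ((1 - θ * (1 - e)) * m - e * ν)) ≤
      C * 2 ^ (-(e * ν)) := by
  have hc : 0 < θ * (1 - e) - 1 := by linarith
  refine ⟨_, inv_one_sub_two_rpow_neg_pos hc, fun ν K => ?_⟩
  refine le_trans (Finset.sum_le_sum fun m _ => (min_le_right _ _).trans (le_of_eq ?_))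
    (sum_two_rpow_sub_le hc _ K)
  congr 1; ring

/-- The second branch is constant in `m`, and the first takes over once `m ≥ e * ν / (θ - 1)`: a
number of equal terms linear in `ν`, then a geometric tail. -/
lemma exists_sum_min_le_of_critical {θ e : ℝ} (hθ : 1 < θ) (he : 0 < e) (h : θ * (1 - e) = 1) :
    ∃ C : ℝ, 0 < C ∧ ∀ (ν : ℝ) (_ : 0 ≤ ν) (K : ℕ),
      ∑ m ∈ Finset.range K,
        min ((2 : ℝ) ^ ((1 - θ) * m)) (2 ^ ((1 - θ * (1 - e)) * m - e * ν)) ≤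
      C * ((1 + ν) * 2 ^ (-(e * ν))) := by
  have hc : 0 < θ - 1 := by linarith
  set G := (1 - (2 : ℝ) ^ (-(θ - 1)))⁻¹ with hG
  have hGpos : 0 < G := inv_one_sub_two_rpow_neg_pos hc
  set ρ := e / (θ - 1) with hρdef
  have hρ : 0 < ρ := by positivity
  refine ⟨1 + ρ + G, by positivity, fun ν hν K => ?_⟩
  set k := ⌈ρ * ν⌉₊ with hk
  have hk₁ : e * ν ≤ (θ - 1) * k := by
    have := Nat.le_ceil (ρ * ν)
    have h' : e = (θ - 1) * ρ := by rw [hρdef]; field_simp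
    rw [h', mul_assoc]; gcongr
  have hk₂ : (k : ℝ) ≤ ρ * ν + 1 := (Nat.ceil_lt_add_one (by positivity)).le
  refine (sum_le_sum_range_add_of_decay (v := -(e * ν)) hc k K (fun l => by positivity)
    fun l _ => ?_).trans ?_
  · refine (min_le_left _ _).trans (Real.rpow_le_rpow_of_exponent_le (by norm_num) ?_)
    nlinarith
  · have hsum : ∑ m ∈ Finset.range k,
        min ((2 : ℝ) ^ ((1 - θ) * m)) (2 ^ ((1 - θ * (1 - e)) * m - e * ν)) ≤
        k * 2 ^ (-(e * ν)) := by
      refine (Finset.sum_le_sum fun m _ => min_le_right _ _).trans (le_of_eq ?_)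
      simp [h]
    have hV : (0 : ℝ) < 2 ^ (-(e * ν)) := by positivity
    calc _ ≤ k * 2 ^ (-(e * ν)) + G * 2 ^ (-(e * ν)) := add_le_add hsum le_rfl
      _ = (k + G) * 2 ^ (-(e * ν)) := by ring
      _ ≤ ((1 + ρ + G) * (1 + ν)) * 2 ^ (-(e * ν)) := by
          gcongr
          nlinarith [mul_pos hρ hGpos, mul_nonneg hρ.le hν, mul_nonneg hGpos.le hν]
      _ = _ := by ring

/-- In dimension one both branches decay in `l`, at rates `1` and `1 / 2`; the slower rate serves
for both. -/
lemma exists_sum_scaleTerm_le_one {θ : ℝ} :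
    ∃ C : ℝ, 0 < C ∧ ∀ (ν : ℝ) (L m : ℕ),
      ∑ l ∈ Finset.range L, scaleTerm θ 1 ν l m ≤
        C * min ((2 : ℝ) ^ ((1 - θ) * m)) (2 ^ ((1 - θ * (1 - 1 / 2)) * m - 1 / 2 * ν)) := by
  have hc : (0 : ℝ) < 1 / 2 := by norm_num
  refine ⟨_, inv_one_sub_two_rpow_neg_pos hc, fun ν L m => ?_⟩
  rw [mul_min_of_nonneg _ _ (inv_one_sub_two_rpow_neg_pos hc).le]
  refine le_min ?_ ?_
  · refine le_trans (Finset.sum_le_sum fun l _ => (min_le_left _ _).trans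
      (Real.rpow_le_rpow_of_exponent_le (by norm_num) ?_)) (sum_two_rpow_sub_le hc _ L)
    have : (0 : ℝ) ≤ l := by positivity
    linarith
  · refine le_trans (Finset.sum_le_sum fun l _ => (min_le_right _ _).trans
      (Real.rpow_le_rpow_of_exponent_le (by norm_num) ?_)) (sum_two_rpow_sub_le hc _ L)
    linarith

/-- In dimension two the second branch does not depend on `l`, so each level contributes equally:
the source of the extra logarithm. -/
lemma sum_scaleTerm_le_two (θ ν : ℝ) (L m : ℕ) :
    ∑ l ∈ Finset.range L, scaleTerm θ 2 ν l m ≤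
      L * min ((2 : ℝ) ^ ((1 - θ) * m)) (2 ^ ((1 - θ * (1 - 1 / 2)) * m - 1 / 2 * ν)) := by
  rw [← nsmul_eq_mul]
  conv_rhs => rw [← Finset.card_range L]
  refine Finset.sum_le_card_nsmul _ _ _ fun l _ => ?_
  have : (0 : ℝ) ≤ l := by positivity
  refine min_le_min (Real.rpow_le_rpow_of_exponent_le (by norm_num) (by linarith))
    (Real.rpow_le_rpow_of_exponent_le (by norm_num) (by linarith))

/-- For `δ > 2` the second branch increases in `l`; its crossing with the first one produces the
exponent `1 / δ`. -/
lemma exists_sum_scaleTerm_le_of_two_lt {θ δ : ℝ} (hδ : 2 < δ) :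
    ∃ C : ℝ, 0 < C ∧ ∀ (ν : ℝ) (L m : ℕ),
      ∑ l ∈ Finset.range L, scaleTerm θ δ ν l m ≤
        C * min ((2 : ℝ) ^ ((1 - θ) * m)) (2 ^ ((1 - θ * (1 - 1 / δ)) * m - 1 / δ * ν)) := by
  obtain ⟨C, hC, h⟩ := exists_sum_min_two_rpow_le (a := 1) (b := δ / 2 - 1) (by norm_num)
    (by linarith)
  have hG := inv_one_sub_two_rpow_neg_pos one_pos
  refine ⟨C + _, add_pos hC hG, fun ν L m => ?_⟩
  have hδ0 : δ ≠ 0 := by linarith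
  rw [mul_min_of_nonneg _ _ (add_pos hC hG).le]
  refine le_min ?_ ?_
  · rw [add_mul]
    refine le_add_of_nonneg_of_le (by positivity) ?_
    refine le_trans (Finset.sum_le_sum fun l _ => (min_le_left _ _).trans (le_of_eq ?_))
      (sum_two_rpow_sub_le one_pos _ L)
    rw [one_mul]
  · rw [add_mul]
    refine le_add_of_le_of_nonneg ?_ (by positivity)
    refine le_trans (le_of_eq (Finset.sum_congr rfl fun l _ => ?_))
      ((h ((1 - θ) * m) ((1 - θ / 2) * m - ν / 2) L).trans (le_of_eq ?_))
    · unfold scaleTerm; congr 2 <;> ring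
    · have h' : 1 + (δ / 2 - 1) = δ / 2 := by ring
      rw [h']; congr 2; field_simp; ring

lemma sum_sum_scaleTerm_le {θ δ e ν D B : ℝ} (hD : 0 ≤ D) {L K : ℕ}
    (h : ∀ m : ℕ, ∑ l ∈ Finset.range L, scaleTerm θ δ ν l m ≤
      D * min ((2 : ℝ) ^ ((1 - θ) * m)) (2 ^ ((1 - θ * (1 - e)) * m - e * ν)))
    (hB : ∑ m ∈ Finset.range K,
      min ((2 : ℝ) ^ ((1 - θ) * m)) (2 ^ ((1 - θ * (1 - e)) * m - e * ν)) ≤ B) :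
    ∑ l ∈ Finset.range L, ∑ m ∈ Finset.range K, scaleTerm θ δ ν l m ≤ D * B := by
  rw [Finset.sum_comm]
  refine (Finset.sum_le_sum fun m _ => h m).trans ?_
  rw [← Finset.mul_sum]
  gcongr

end DyadicSums

/-! ### Comparison of the dyadic sums with the rate -/

section Rate

lemma natCast_rpow_eq_two_rpow {n : ℕ} (hn : 1 ≤ n) (y : ℝ) :
    (n : ℝ) ^ y = 2 ^ (y * Real.logb 2 n) := by
  have hn0 : (0 : ℝ) < n := by exact_mod_cast hn
  rw [mul_comm, Real.rpow_mul (by norm_num), Real.rpow_logb (by norm_num) (by norm_num) hn0]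

lemma logb_two_le (n : ℕ) : Real.logb 2 n ≤ 2 * Real.log n := by
  have h2 := Real.log_two_gt_d9
  have hlog : 0 ≤ Real.log n := Real.log_natCast_nonneg n
  rw [Real.logb, div_le_iff₀ (by linarith)]
  nlinarith

/-- The multiscale sums are of the order of the rate, as soon as the finest scale is at most of
the order of the rate. -/
lemma exists_sum_scaleTerm_le_rate {θ : ℝ} (hθ : 1 < θ) {d : ℕ} (hd : 1 ≤ d) :
    ∃ C : ℝ, 0 < C ∧ ∀ n : ℕ, 1 ≤ n → ∃ L : ℕ, 1 / (2 : ℝ) ^ L ≤ C * rate θ d n ∧ ∀ K : ℕ,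
      ∑ l ∈ Finset.range (L + 1), ∑ m ∈ Finset.range K,
        scaleTerm θ d (Real.logb 2 n) l m ≤ C * rate θ d n := by
  have hlog0 : ∀ n : ℕ, 0 ≤ Real.log n := Real.log_natCast_nonneg
  have hν0 : ∀ n : ℕ, 1 ≤ n → 0 ≤ Real.logb 2 n := fun n hn =>
    Real.logb_nonneg (by norm_num) (by exact_mod_cast hn)
  -- The depth will be `⌈logb 2 n / max d 2⌉`, so that `2 ^ (-L) ≤ n ^ (-1 / max d 2)`. The bound on
  -- the number of levels matters only for `d = 2`.
  suffices H : ∃ C : ℝ, 0 < C ∧ ∀ n : ℕ, 1 ≤ n →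
      (2 : ℝ) ^ (-(1 / max (d : ℝ) 2 * Real.logb 2 n)) ≤ rate θ d n ∧
      ∀ L K : ℕ, (L : ℝ) ≤ 2 + Real.logb 2 n →
        ∑ l ∈ Finset.range L, ∑ m ∈ Finset.range K,
          scaleTerm θ d (Real.logb 2 n) l m ≤ C * rate θ d n by
    obtain ⟨C, hC, H⟩ := H
    refine ⟨max C 1, by positivity, fun n hn => ?_⟩
    obtain ⟨h₁, h₂⟩ := H n hn
    have hrate : 0 ≤ rate θ d n := (by positivity : (0 : ℝ) ≤ _).trans h₁
    have hν := hν0 n hn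
    have hmax : (1 : ℝ) / max (d : ℝ) 2 ≤ 1 := by
      rw [div_le_one (by positivity)]; exact le_max_of_le_right (by norm_num)
    have hx : 0 ≤ 1 / max (d : ℝ) 2 * Real.logb 2 n := by positivity
    refine ⟨⌈1 / max (d : ℝ) 2 * Real.logb 2 n⌉₊, ?_, fun K => ?_⟩
    · calc 1 / (2 : ℝ) ^ ⌈1 / max (d : ℝ) 2 * Real.logb 2 n⌉₊
          = 2 ^ (-(⌈1 / max (d : ℝ) 2 * Real.logb 2 n⌉₊ : ℝ)) := by
            rw [Real.rpow_neg (by norm_num), Real.rpow_natCast, one_div]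
        _ ≤ 2 ^ (-(1 / max (d : ℝ) 2 * Real.logb 2 n)) :=
            Real.rpow_le_rpow_of_exponent_le (by norm_num) (neg_le_neg (Nat.le_ceil _))
        _ ≤ rate θ d n := h₁
        _ ≤ _ := le_mul_of_one_le_left hrate (le_max_right _ _)
    · refine (h₂ _ K ?_).trans (by gcongr; exact le_max_left _ _)
      have := (Nat.ceil_lt_add_one hx).le
      push_cast
      nlinarith
  -- One condition for the three heavy-tail lines: it says `θ < 2` if `d ≤ 2`, and `θ < d / (d - 1)`
  -- if `d ≥ 3`.
  by_cases hheavy : θ < 2 ∧ (θ - 1) * d < θ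
  · obtain ⟨h2, hδ⟩ := hheavy
    obtain ⟨C, hC, h⟩ := exists_sum_scaleTerm_le_of_heavy_tail hθ h2 hδ
    refine ⟨C, hC, fun n hn => ?_⟩
    have hr : rate θ d n = 2 ^ ((1 / θ - 1) * Real.logb 2 n) := by
      rw [← natCast_rpow_eq_two_rpow hn]
      unfold rate
      by_cases h₁ : d = 1
      · rw [if_pos h₁, if_pos h2]
      by_cases h₂ : d = 2
      · rw [if_neg h₁, if_pos h₂, if_pos h2]
      · have h3 : (3 : ℝ) ≤ d := by exact_mod_cast (by omega : 3 ≤ d)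
        rw [if_neg h₁, if_neg h₂, if_pos]
        rw [lt_div_iff₀ (by linarith)]; nlinarith
    rw [hr]
    refine ⟨Real.rpow_le_rpow_of_exponent_le (by norm_num) ?_, fun L K _ => h _ L K⟩
    have hν := hν0 n hn
    rw [← neg_mul]
    refine mul_le_mul_of_nonneg_right ?_ hν
    rcases max_choice (d : ℝ) 2 with hm | hm
    · rw [hm]
      have hd0 : (0 : ℝ) < d := by exact_mod_cast hd
      have : 1 - 1 / θ ≤ 1 / d := by
        rw [le_div_iff₀ hd0, sub_mul, one_mul]
        have hh : 1 / θ * θ = 1 := by field_simp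
        have := mul_le_mul_of_nonneg_left hδ.le (by positivity : 0 ≤ 1 / θ)
        nlinarith
      linarith
    · rw [hm]
      have : 1 / 2 ≤ 1 / θ := by gcongr
      linarith
  · have hd12 : d = 1 ∨ d = 2 ∨ 3 ≤ d := by omega
    rcases hd12 with rfl | rfl | hd3
    · have hθ2 : 2 ≤ θ := by
        by_contra! h; exact hheavy ⟨h, by push_cast; linarith⟩
      obtain ⟨D, hD, hin⟩ := exists_sum_scaleTerm_le_one (θ := θ)
      have hmax : max ((1 : ℕ) : ℝ) 2 = 2 := by norm_num
      rw [hmax]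
      rcases hθ2.eq_or_lt with h2 | h2
      · subst h2
        obtain ⟨C, hC, hout⟩ := exists_sum_min_le_of_critical (θ := 2) (e := 1 / 2)
          (by norm_num) (by norm_num) (by norm_num)
        refine ⟨D * C * 2, by positivity, fun n hn => ?_⟩
        have hr : rate 2 1 n = (1 + Real.log n) * 2 ^ (-(1 / 2 * Real.logb 2 n)) := by
          rw [← neg_mul, ← natCast_rpow_eq_two_rpow hn]; simp [rate]
        rw [hr]
        have hl := hlog0 n
        have hlν := logb_two_le n
        refine ⟨le_mul_of_one_le_left (by positivity) (by linarith), fun L K _ => ?_⟩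
        push_cast
        refine (sum_sum_scaleTerm_le hD.le (fun m => hin _ L m)
          (hout _ (hν0 n hn) K)).trans ?_
        have : 1 + Real.logb 2 n ≤ 2 * (1 + Real.log n) := by linarith
        calc _ ≤ D * (C * ((2 * (1 + Real.log n)) * 2 ^ (-(1 / 2 * Real.logb 2 n)))) := by gcongr
          _ = _ := by ring
      · obtain ⟨C, hC, hout⟩ := exists_sum_min_le_of_supercritical (θ := θ) (e := 1 / 2)
          (by linarith)
        refine ⟨D * C, by positivity, fun n hn => ?_⟩
        have hr : rate θ 1 n = 2 ^ (-(1 / 2 * Real.logb 2 n)) := by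
          rw [← neg_mul, ← natCast_rpow_eq_two_rpow hn]
          simp [rate, h2.not_gt, h2.ne']
        rw [hr]
        refine ⟨le_rfl, fun L K _ => ?_⟩
        push_cast
        refine (sum_sum_scaleTerm_le hD.le (fun m => hin _ L m) (hout _ K)).trans (le_of_eq ?_)
        ring
    · have hθ2 : 2 ≤ θ := by
        by_contra! h; exact hheavy ⟨h, by push_cast; linarith⟩
      have hmax : max ((2 : ℕ) : ℝ) 2 = 2 := by norm_num
      rw [hmax]
      rcases hθ2.eq_or_lt with h2 | h2
      · subst h2
        obtain ⟨C, hC, hout⟩ := exists_sum_min_le_of_critical (θ := 2) (e := 1 / 2)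
          (by norm_num) (by norm_num) (by norm_num)
        -- Levels and annuli each contribute a logarithm; `7` comes from `(2 + 2 * x) * (1 + 2 * x)
        -- ≤ 7 * (1 + x ^ 2)` at `x = log n`.
        refine ⟨7 * C, by positivity, fun n hn => ?_⟩
        have hr : rate 2 2 n = (1 + Real.log n ^ 2) * 2 ^ (-(1 / 2 * Real.logb 2 n)) := by
          rw [← neg_mul, ← natCast_rpow_eq_two_rpow hn]; simp [rate]
        rw [hr]
        have hl := hlog0 n
        have hν := hν0 n hn
        have hlν := logb_two_le n
        refine ⟨le_mul_of_one_le_left (by positivity) (by nlinarith), fun L K hL => ?_⟩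
        push_cast
        refine (sum_sum_scaleTerm_le (Nat.cast_nonneg L)
          (fun m => sum_scaleTerm_le_two 2 _ L m) (hout _ hν K)).trans ?_
        have h7 : (L : ℝ) * (1 + Real.logb 2 n) ≤ 7 * (1 + Real.log n ^ 2) := by
          calc (L : ℝ) * (1 + Real.logb 2 n)
              ≤ (2 + 2 * Real.log n) * (1 + 2 * Real.log n) := by gcongr; linarith
            _ ≤ _ := by nlinarith [sq_nonneg (Real.log n - 1)]
        calc _ = C * (L * (1 + Real.logb 2 n)) * 2 ^ (-(1 / 2 * Real.logb 2 n)) := by ring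
          _ ≤ C * (7 * (1 + Real.log n ^ 2)) * 2 ^ (-(1 / 2 * Real.logb 2 n)) := by gcongr
          _ = _ := by ring
      · obtain ⟨C, hC, hout⟩ := exists_sum_min_le_of_supercritical (θ := θ) (e := 1 / 2)
          (by linarith)
        refine ⟨2 * C, by positivity, fun n hn => ?_⟩
        have hr : rate θ 2 n = (1 + Real.log n) * 2 ^ (-(1 / 2 * Real.logb 2 n)) := by
          rw [← neg_mul, ← natCast_rpow_eq_two_rpow hn]
          simp [rate, h2.not_gt, h2.ne']
        rw [hr]
        have hl := hlog0 n
        have hlν := logb_two_le n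
        refine ⟨le_mul_of_one_le_left (by positivity) (by linarith), fun L K hL => ?_⟩
        push_cast
        refine (sum_sum_scaleTerm_le (Nat.cast_nonneg L)
          (fun m => sum_scaleTerm_le_two θ _ L m) (hout _ K)).trans ?_
        have : (L : ℝ) ≤ 2 * (1 + Real.log n) := by linarith
        calc _ ≤ (2 * (1 + Real.log n)) * (C * 2 ^ (-(1 / 2 * Real.logb 2 n))) := by gcongr
          _ = _ := by ring
    · have h3 : (3 : ℝ) ≤ d := by exact_mod_cast hd3
      have hd1 : d ≠ 1 := by omega
      have hd2 : d ≠ 2 := by omega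
      have hθd : (d : ℝ) / (d - 1) ≤ θ := by
        rw [div_le_iff₀ (by linarith)]
        by_contra! h
        exact hheavy ⟨by nlinarith, by nlinarith⟩
      have hmax : max (d : ℝ) 2 = d := max_eq_left (by linarith)
      rw [hmax]
      obtain ⟨D, hD, hin⟩ := exists_sum_scaleTerm_le_of_two_lt (θ := θ) (δ := d) (by linarith)
      have he : 1 - 1 / (d : ℝ) = ((d : ℝ) / (d - 1))⁻¹ := by
        rw [inv_div]; field_simp
      have hpos : (0 : ℝ) < d / (d - 1) := div_pos (by linarith) (by linarith)
      rcases hθd.eq_or_lt with h2 | h2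
      · obtain ⟨C, hC, hout⟩ := exists_sum_min_le_of_critical (θ := θ) (e := 1 / (d : ℝ))
          hθ (by positivity) (by rw [he, ← h2]; exact mul_inv_cancel₀ hpos.ne')
        refine ⟨D * C * 2, by positivity, fun n hn => ?_⟩
        have hr : rate θ d n = (1 + Real.log n) * 2 ^ (-(1 / (d : ℝ) * Real.logb 2 n)) := by
          rw [← neg_mul, ← natCast_rpow_eq_two_rpow hn, rate, if_neg hd1, if_neg hd2,
            if_neg h2.symm.not_lt, if_pos h2.symm]
        rw [hr]
        have hl := hlog0 n
        have hlν := logb_two_le n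
        refine ⟨le_mul_of_one_le_left (by positivity) (by linarith), fun L K _ => ?_⟩
        refine (sum_sum_scaleTerm_le hD.le (fun m => hin _ L m)
          (hout _ (hν0 n hn) K)).trans ?_
        have : 1 + Real.logb 2 n ≤ 2 * (1 + Real.log n) := by linarith
        calc _ ≤ D * (C * ((2 * (1 + Real.log n)) * 2 ^ (-(1 / (d : ℝ) * Real.logb 2 n)))) := by
              gcongr
          _ = _ := by ring
      · obtain ⟨C, hC, hout⟩ := exists_sum_min_le_of_supercritical (θ := θ) (e := 1 / (d : ℝ))
          (by rw [he, ← div_eq_mul_inv, one_lt_div hpos]; exact h2)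
        refine ⟨D * C, by positivity, fun n hn => ?_⟩
        have hr : rate θ d n = 2 ^ (-(1 / (d : ℝ) * Real.logb 2 n)) := by
          rw [← neg_mul, ← natCast_rpow_eq_two_rpow hn, rate, if_neg hd1, if_neg hd2,
            if_neg h2.not_gt, if_neg h2.ne']
        rw [hr]
        refine ⟨le_rfl, fun L K _ => ?_⟩
        refine (sum_sum_scaleTerm_le hD.le (fun m => hin _ L m) (hout _ K)).trans (le_of_eq ?_)
        ring

end Rate

/-! ### From the moment bound to the rate for one law -/

section MomentBound

variable {d : ℕ} {μ : Measure (L1Space d)} {θ M : ℝ}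

lemma lintegral_const_mul_one_add_norm_rpow_le [IsProbabilityMeasure μ] (hM : 0 ≤ M)
    (hmom : ∫⁻ x, ENNReal.ofReal (‖x‖ ^ θ) ∂μ ≤ ENNReal.ofReal M) {c : ℝ} (hc : 0 ≤ c) :
    ∫⁻ x, ENNReal.ofReal (c * (1 + ‖x‖ ^ θ)) ∂μ ≤ ENNReal.ofReal (c * (1 + M)) := by
  have h : ∀ x : L1Space d, ENNReal.ofReal (c * (1 + ‖x‖ ^ θ)) =
      ENNReal.ofReal c * (1 + ENNReal.ofReal (‖x‖ ^ θ)) := fun x => by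
    rw [ENNReal.ofReal_mul hc, ENNReal.ofReal_add zero_le_one (by positivity), ENNReal.ofReal_one]
  simp_rw [h]
  rw [lintegral_const_mul _ (by fun_prop), lintegral_add_left measurable_const, lintegral_const,
    measure_univ, mul_one, ENNReal.ofReal_mul hc, ENNReal.ofReal_add zero_le_one hM,
    ENNReal.ofReal_one]
  gcongr

/-- Markov's inequality for `1 + ‖x‖ ^ θ`; the summand `1` covers the unit ball, where `‖x‖` has no
lower bound. -/
lemma measureReal_annulus_le [IsProbabilityMeasure μ] (hθ : 0 ≤ θ) (hM : 0 ≤ M)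
    (hmom : ∫⁻ x, ENNReal.ofReal (‖x‖ ^ θ) ∂μ ≤ ENNReal.ofReal M) (m : ℕ) :
    μ.real (annulus ⁻¹' {m}) ≤ 2 ^ θ * (1 + M) * 2 ^ (-(θ * m)) := by
  have hsub : (annulus ⁻¹' {m} : Set (L1Space d)) ⊆
      {x | ENNReal.ofReal (2 ^ (θ * m)) ≤ ENNReal.ofReal (2 ^ θ * (1 + ‖x‖ ^ θ))} := by
    intro x hx
    refine ENNReal.ofReal_le_ofReal ?_
    have h := two_pow_annulus_le x
    rw [show annulus x = m from hx] at h
    have h' : (2 : ℝ) ^ (θ * m) = ((2 : ℝ) ^ m) ^ θ := by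
      rw [← Real.rpow_natCast, ← Real.rpow_mul (by norm_num), mul_comm]
    rw [h']
    refine (Real.rpow_le_rpow (by positivity) h hθ).trans ?_
    have h1 : (1 : ℝ) ≤ 2 ^ θ := Real.one_le_rpow (by norm_num) hθ
    have h2 : 0 ≤ ‖x‖ ^ θ := by positivity
    rcases max_choice 1 (2 * ‖x‖) with hm | hm
    · rw [hm, Real.one_rpow]; nlinarith
    · rw [hm, Real.mul_rpow (by norm_num) (norm_nonneg _)]; nlinarith
  have hmk := mul_meas_ge_le_lintegral (μ := μ)
    (f := fun x => ENNReal.ofReal (2 ^ θ * (1 + ‖x‖ ^ θ))) (by fun_prop)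
    (ENNReal.ofReal (2 ^ (θ * m)))
  have h := ((mul_le_mul_right (measure_mono hsub) _).trans hmk).trans
    (lintegral_const_mul_one_add_norm_rpow_le hM hmom (by positivity))
  rw [← ofReal_measureReal, ← ENNReal.ofReal_mul (by positivity),
    ENNReal.ofReal_le_ofReal_iff (by positivity)] at h
  rw [Real.rpow_neg (by norm_num), ← div_eq_mul_inv, le_div_iff₀ (by positivity), mul_comm]
  exact h

/-- `K ≥ 1` gives `K ≤ K ^ 2`, so `K` leaves the square root as a linear factor; this makes the
final bound linear in `1 + M`. The factor `2 ^ (d + 1)` covers both `2` and `√(4 ^ d)`. -/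
lemma mul_min_sqrt_le_scaleTerm {p : ℝ} {n : ℕ} (hn : 1 ≤ n) (l m : ℕ) {K : ℝ}
    (hK : 1 ≤ K) (hp : p ≤ K * 2 ^ (-(θ * m))) :
    2 * d * 2 ^ m / 2 ^ l * min (2 * p) (Real.sqrt (4 ^ d * 2 ^ (l * d) * p / n)) ≤
      2 * d * 2 ^ (d + 1) * K * scaleTerm θ d (Real.logb 2 n) l m := by
  have hn0 : (0 : ℝ) < n := by exact_mod_cast hn
  set ν := Real.logb 2 n with hν
  have hnν : (n : ℝ) = 2 ^ ν := (Real.rpow_logb (by norm_num) (by norm_num) hn0).symm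
  have h2d : (1 : ℝ) ≤ 2 ^ d := one_le_pow₀ (by norm_num)
  have hsc : scaleTerm θ d ν l m = 2 ^ m / 2 ^ l *
      min ((2 : ℝ) ^ (-(θ * m))) (2 ^ ((l * d - θ * m - ν) / 2)) := by
    rw [mul_min_of_nonneg _ _ (by positivity), scaleTerm, ← Real.rpow_natCast 2 m,
      ← Real.rpow_natCast 2 l, ← Real.rpow_sub (by norm_num), ← Real.rpow_add (by norm_num),
      ← Real.rpow_add (by norm_num)]
    congr 2 <;> ring
  have hmin : min (2 * p) (Real.sqrt (4 ^ d * 2 ^ (l * d) * p / n)) ≤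
      2 ^ (d + 1) * K * min ((2 : ℝ) ^ (-(θ * m))) (2 ^ ((l * d - θ * m - ν) / 2)) := by
    rw [mul_min_of_nonneg _ _ (by positivity)]
    refine min_le_min ?_ ?_
    · have h0 : 0 ≤ K * (2 : ℝ) ^ (-(θ * m)) := by positivity
      rw [pow_succ]
      nlinarith
    · refine Real.sqrt_le_iff.2 ⟨by positivity, ?_⟩
      have hsq : ((2 : ℝ) ^ ((l * d - θ * m - ν) / 2)) ^ 2 =
          2 ^ (l * d) * 2 ^ (-(θ * m)) / n := by
        rw [hnν, ← Real.rpow_natCast, ← Real.rpow_mul (by norm_num), ← Real.rpow_natCast 2 (l * d),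
          ← Real.rpow_add (by norm_num), ← Real.rpow_sub (by norm_num)]
        congr 1; push_cast; ring
      have h4 : ((2 : ℝ) ^ (d + 1)) ^ 2 = 4 ^ (d + 1) := by
        rw [← pow_mul, mul_comm, pow_mul]; norm_num
      rw [mul_pow, hsq, mul_pow, h4]
      calc (4 : ℝ) ^ d * 2 ^ (l * d) * p / n
          ≤ 4 ^ d * 2 ^ (l * d) * (K * 2 ^ (-(θ * m))) / n := by gcongr
        _ ≤ 4 ^ (d + 1) * 2 ^ (l * d) * (K ^ 2 * 2 ^ (-(θ * m))) / n := by
            gcongr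
            · norm_num
            · omega
            · nlinarith
        _ = _ := by ring
  rw [hsc]
  calc _ ≤ 2 * d * 2 ^ m / 2 ^ l * (2 ^ (d + 1) * K *
        min ((2 : ℝ) ^ (-(θ * m))) (2 ^ ((l * d - θ * m - ν) / 2))) := by gcongr
    _ = _ := by ring

/-- The mean rate of convergence of the empirical measure in Wasserstein distance under a finite
moment of order `θ > 1`. -/
theorem exists_lintegral_wasserstein_empirical_le_rate (hθ : 1 < θ) (hd : 1 ≤ d) :
    ∃ C : ℝ, 0 < C ∧ ∀ n : ℕ, 1 ≤ n → 0 ≤ rate θ d n ∧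
      ∀ (M : ℝ) (_ : 0 ≤ M) (μ : Measure (L1Space d))
        (_ : ∫⁻ x, ENNReal.ofReal (‖x‖ ^ θ) ∂μ ≤ ENNReal.ofReal M)
        {Ω : Type*} [MeasurableSpace Ω] (P : Measure Ω) [IsProbabilityMeasure P]
        (X : ℕ → Ω → L1Space d) (_ : ∀ i, Measurable (X i)) (_ : iIndepFun X P)
        (_ : ∀ i, P.map (X i) = μ),
        ∫⁻ ω, wasserstein (empirical n fun i => X i ω) μ ∂P ≤
          ENNReal.ofReal (C * (1 + M) * rate θ d n) := by
  obtain ⟨C, hC, hsum⟩ := exists_sum_scaleTerm_le_rate hθ hd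
  have hd0 : (0 : ℝ) < d := by exact_mod_cast hd
  -- The first summand pays for the tree, the second for the two discretization legs, using `1 + 2 *
  -- ‖x‖ ≤ 3 * (1 + ‖x‖ ^ θ)`.
  refine ⟨2 * d * 2 ^ (d + 1) * 2 ^ θ * C + 6 * d * C, by positivity, fun n hn => ?_⟩
  obtain ⟨L, hL, hsum⟩ := hsum n hn
  have hrate : 0 ≤ rate θ d n := by
    have : 0 ≤ C * rate θ d n := le_trans (by positivity) hL
    exact nonneg_of_mul_nonneg_right this hC
  refine ⟨hrate, fun M hM μ hmom Ω _ P _ X hX hind hμ => ?_⟩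
  have hprob : IsProbabilityMeasure μ := by
    rw [← hμ 0]; exact Measure.isProbabilityMeasure_map (hX 0).aemeasurable
  set K := 2 ^ θ * (1 + M) with hK
  have hK1 : 1 ≤ K := one_le_mul_of_one_le_of_one_le
    (Real.one_le_rpow (by norm_num) (by linarith)) (by linarith)
  set c := 2 * d * 2 ^ (d + 1) * K with hc
  have hc0 : 0 ≤ c := by positivity
  have hmain : ∑ l ∈ Finset.range (L + 1), ∑' m : ℕ, ENNReal.ofReal (2 * d * 2 ^ m / 2 ^ l *
      min (2 * μ.real (annulus ⁻¹' {m}))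
        (Real.sqrt (4 ^ d * 2 ^ (l * d) * μ.real (annulus ⁻¹' {m}) / n))) ≤
      ENNReal.ofReal (c * (C * rate θ d n)) := by
    refine (Finset.sum_le_sum fun l _ => ENNReal.tsum_le_tsum fun m => ENNReal.ofReal_le_ofReal
      (mul_min_sqrt_le_scaleTerm hn l m hK1
        (measureReal_annulus_le (by linarith) hM hmom m))).trans ?_
    -- The series over annuli is the supremum of its partial sums, for which the bounds on
    -- `scaleTerm` are uniform.
    rw [← Summable.tsum_finsetSum fun _ _ => ENNReal.summable, ENNReal.tsum_eq_iSup_nat]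
    refine iSup_le fun k => ?_
    have h0 : ∀ l m, 0 ≤ c * scaleTerm θ d (Real.logb 2 n) l m := fun l m =>
      mul_nonneg hc0 (scaleTerm_nonneg _ _ _ _ _)
    have h1 : ∀ m, ∑ l ∈ Finset.range (L + 1),
        ENNReal.ofReal (c * scaleTerm θ d (Real.logb 2 n) l m) =
        ENNReal.ofReal (∑ l ∈ Finset.range (L + 1), c * scaleTerm θ d (Real.logb 2 n) l m) :=
      fun m => (ENNReal.ofReal_sum_of_nonneg fun l _ => h0 l m).symm
    simp_rw [← hc, h1]
    rw [← ENNReal.ofReal_sum_of_nonneg fun m _ => Finset.sum_nonneg fun l _ => h0 l m,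
      Finset.sum_comm]
    simp_rw [← Finset.mul_sum]
    exact ENNReal.ofReal_le_ofReal (mul_le_mul_of_nonneg_left (hsum k) hc0)
  have hrem : ∫⁻ x, ENNReal.ofReal (d / 2 ^ L * (1 + 2 * ‖x‖)) ∂μ ≤
      ENNReal.ofReal (3 * d * (C * rate θ d n) * (1 + M)) := by
    refine le_trans (lintegral_mono fun x => ENNReal.ofReal_le_ofReal ?_)
      (lintegral_const_mul_one_add_norm_rpow_le (θ := θ) hM hmom (by positivity))
    have hx : ‖x‖ ≤ 1 + ‖x‖ ^ θ := by
      rcases le_total ‖x‖ 1 with h | h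
      · linarith [Real.rpow_nonneg (norm_nonneg x) θ]
      · linarith [Real.self_le_rpow_of_one_le h hθ.le]
    have hx' : 1 + 2 * ‖x‖ ≤ 3 * (1 + ‖x‖ ^ θ) := by
      linarith [Real.rpow_nonneg (norm_nonneg x) θ]
    calc d / 2 ^ L * (1 + 2 * ‖x‖) = d * (1 / 2 ^ L) * (1 + 2 * ‖x‖) := by ring
      _ ≤ d * (C * rate θ d n) * (3 * (1 + ‖x‖ ^ θ)) := by gcongr
      _ = _ := by ring
  refine (lintegral_wasserstein_empirical_le hd hX hind hμ hn L).trans ?_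
  refine (add_le_add hmain (mul_le_mul_right hrem 2)).trans (le_of_eq ?_)
  rw [show (2 : ℝ≥0∞) = ENNReal.ofReal 2 by simp, ← ENNReal.ofReal_mul (by norm_num),
    ← ENNReal.ofReal_add (by positivity) (by positivity)]
  congr 1
  rw [hc, hK]; ring

end MomentBound

/-! ### The bound for the vector of marginals -/

theorem mainTheorem11 (θ : ℝ) (hθ : 1 < θ) (d : ℕ) (hd : 1 ≤ d) :
    ∃ C : ℝ, 0 < C ∧
      ∀ (M : ℝ) (N : ℕ) (hN : 1 ≤ N) (μ : Fin N → Measure (L1Space d)),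
        (∃ P, IsMartingalePlan μ P) →
        Integrable (fun x => ‖x‖ ^ θ) (μ ⟨N - 1, by omega⟩) →
        ∫ x, ‖x‖ ^ θ ∂(μ ⟨N - 1, by omega⟩) ≤ M →
        ∀ {Ω : Type*} [MeasurableSpace Ω] (Pr : Measure Ω) [IsProbabilityMeasure Pr]
          (X : Fin N → ℕ → Ω → L1Space d),
          (∀ k i, Measurable (X k i)) →
          (∀ k, iIndepFun (X k) Pr) →
          (∀ k i, Pr.map (X k i) = μ k) →
          ∀ n : ℕ, 1 ≤ n →
            Measurable (fun ω => wassersteinSum (fun k => empirical n (fun i => X k i ω)) μ) ∧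
            ∫⁻ ω, wassersteinSum (fun k => empirical n (fun i => X k i ω)) μ ∂Pr
              ≤ ENNReal.ofReal (chi C M θ d N n) ∧
            ∀ ε : ℝ, 0 < ε →
              Pr {ω | ENNReal.ofReal ε <
                  wassersteinSum (fun k => empirical n (fun i => X k i ω)) μ}
                ≤ ENNReal.ofReal (chi C M θ d N n / ε) := by
  obtain ⟨C, hC, H⟩ := exists_lintegral_wasserstein_empirical_le_rate (d := d) hθ hd
  refine ⟨C, hC, fun M N hN μ hplan hint hM Ω _ Pr _ X hX hind hlaw n hn => ?_⟩
  obtain ⟨P, hP⟩ := hplan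
  have hM0 : 0 ≤ M := (integral_nonneg fun x => by positivity).trans hM
  obtain ⟨hrate, H⟩ := H n hn
  have hmeas : ∀ k, Measurable fun ω => wasserstein (empirical n fun i => X k i ω) (μ k) :=
    fun k => measurable_wasserstein_empirical (hX k) hn (μ k)
  have hexp : ∫⁻ ω, wassersteinSum (fun k => empirical n (fun i => X k i ω)) μ ∂Pr
      ≤ ENNReal.ofReal (chi C M θ d N n) := by
    simp only [wassersteinSum]
    rw [lintegral_finsetSum _ fun k _ => hmeas k]
    -- The only use of the martingale plan: every marginal inherits the moment bound `M` of the last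
    -- one.
    refine (Finset.sum_le_sum fun k _ => H M hM0 (μ k) (hP.lintegral_norm_rpow_le hθ.le
      (Fin.le_def.2 (by simp; omega)) hint hM) Pr (X k) (hX k) (hind k) (hlaw k)).trans ?_
    rw [Finset.sum_const, Finset.card_univ, Fintype.card_fin, nsmul_eq_mul,
      ← ENNReal.ofReal_natCast, ← ENNReal.ofReal_mul (by positivity), chi, mul_assoc (N : ℝ)]
  have hsum : Measurable fun ω => wassersteinSum (fun k => empirical n (fun i => X k i ω)) μ :=
    Finset.measurable_fun_sum _ fun k _ => hmeas k
  refine ⟨hsum, hexp, fun ε hε => ?_⟩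
  refine (measure_mono (Set.ofPred_subset_ofPred.2 fun ω hω => le_of_lt hω)).trans
    ((meas_ge_le_lintegral_div hsum.aemeasurable (ENNReal.ofReal_pos.2 hε).ne'
      ENNReal.ofReal_ne_top).trans ?_)
  rw [ENNReal.ofReal_div_of_pos hε]
  gcongr
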